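/- Conventions. $\mathbf{Diff}$ is the category of finite-dimensional, Hausdorff, second countable $C^\infty$ manifolds without boundary and smooth maps; $T:\mathbf{Diff}\to\mathbf{Diff}$, $X\mapsto TX$, $f\mapsto Tf$, is the tangent functor and $p_X:TX\to X$ the canonical projection. $\mathbb R\text{-}\mathbf{Alg}$ is the category of commutative $\mathbb R$-algebras. For such an algebra $A$ put $\mathrm{Spec}_{\mathbb R}(A)=\mathrm{Hom}_{\mathbb R\text{-}\mathbf{Alg}}(A,\mathbb R)$ with the initial topology for the functions $\rho(a):p\mapsto p(a)$, $a\in A$. The algebra $A$ is called smooth if $\rho:A\to C(\mathrm{Spec}_{\mathbb R}(A),\mathbb R)$ is injective and, for all $n$, all $a_1,\dots,a_n\in A$ and all $f\in C^\infty(\mathbb R^n)$, the function $f\circ\langle\rho(a_1),\dots,\rho(a_n)\rangle$ lies in $\mathrm{Im}(\rho)$. Let $\iota:\mathbb R\text{-}\mathtt{Sm}\text{-}\mathbf{Alg}\hookrightarrow\mathbb R\text{-}\mathbf{Alg}$ be the full subcategory of smooth algebras and $\mathtt{Sm}$ the left adjoint of $\iota$ (smooth completion): $\mathtt{Sm}(A)$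 is the algebra of all functions $f\circ\langle\rho(a_1),\dots,\rho(a_n)\rangle$ on $\mathrm{Spec}_{\mathbb R}(A)$ with $f\in C^\infty(\mathbb R^n)$, $a_i\in A$. Let $\mathbf{Sym}\text{-}\mathbf{Alg}$ be the category of commutative $\mathbb N$-graded $\mathbb R$-algebras $\mathcal A$ with an $\mathbb R$-linear $d:\mathcal A^0\to\mathcal A^1$ satisfying the Leibniz rule (arrows: algebra homomorphisms of degree $0$ respecting $d$), $U:\mathbf{Sym}\text{-}\mathbf{Alg}\to\mathbb R\text{-}\mathbf{Alg}$ the functor forgetting $d$ and the grading, and $\mathbf{Sym}:\mathbb R\text{-}\mathbf{Alg}\to\mathbf{Sym}\text{-}\mathbf{Alg}$ the functor sending $C$ to the symmetric $C$-algebra of the module of Kähler differentials $\Omega_{C/\mathbb R}$, with the universal $d$. Put $$\mathcal T:=\mathtt{Sm}\circ U\circ\mathbf{Sym}\circ\iota:\ \mathbb R\text{-}\mathtt{Sm}\text{-}\mathbf{Alg}\to\mathbb R\text{-}\mathtt{Sm}\text{-}\mathbf{Alg},$$ and let $i_A:A\to\mathcal T(A)$ be the canonical map $A=\mathbf{Sym}(A)^0\to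 U\,\mathbf{Sym}(A)\to\mathtt{Sm}(U\,\mathbf{Sym}(A))$. Proposition 3.1.1. The composite $\mathcal T$ is the tangent functor on smooth algebras, and $i$ corresponds to the projection of the tangent bundle. That is, there is an isomorphism $$e_X:\ C^\infty(TX)\ \xrightarrow{\ \sim\ }\ \mathcal T(C^\infty(X)),$$ natural in $X\in\mathbf{Diff}$, such that: 1. $(\mathcal T,e)$ is the canonical extension of the tangent functor from manifolds to all smooth algebras, i.e. the left Kan extension of $C^\infty\circ T^{op}:\mathbf{Diff}^{op}\to\mathbb R\text{-}\mathtt{Sm}\text{-}\mathbf{Alg}$ along $C^\infty:\mathbf{Diff}^{op}\to\mathbb R\text{-}\mathtt{Sm}\text{-}\mathbf{Alg}$; 2. for every manifold $X$, $\ e_X\circ p_X^{*}=i_{C^\infty(X)}$, where $p_X^*:C^\infty(X)\to C^\infty(TX)$ is composition with $p_X$; and $i_A$ is injective for every smooth algebra $A$. -/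

import Mathlib

open CategoryTheory
open scoped Manifold ContDiff Bundle

noncomputable section

/-- A smooth manifold: finite-dimensional, Hausdorff, second countable, without boundary. -/
structure DiffMan where
  /-- the underlying space -/
  carrier : Type
  /-- the model vector space -/
  E : Type
  /-- the model space, identified with `E` by the boundaryless model `I` -/
  H : Type
  [normedE : NormedAddCommGroup E]
  [spaceE : NormedSpace ℝ E]
  [finE : FiniteDimensional ℝ E]
  [topH : TopologicalSpace H]
  /-- the model -/
  I : ModelWithCorners ℝ E H
  [noBoundary : I.Boundaryless]
  [top : TopologicalSpace carrier]
  [charted : ChartedSpace H carrier]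
  [smooth : IsManifold I ∞ carrier]
  [t2 : T2Space carrier]
  [secondCountable : SecondCountableTopology carrier]

namespace DiffMan

attribute [instance] normedE spaceE finE topH noBoundary top charted smooth t2 secondCountable

instance category : Category DiffMan where
  Hom X Y := C^∞⟮X.I, X.carrier; Y.I, Y.carrier⟯
  id _ := ContMDiffMap.id
  comp f g := g.comp f

/-- The underlying smooth map of a morphism. -/
def Hom.toMap {X Y : DiffMan} (f : X ⟶ Y) : C^∞⟮X.I, X.carrier; Y.I, Y.carrier⟯ := f

/-- A smooth map as a morphism. -/
def ofMap {X Y : DiffMan} (f : C^∞⟮X.I, X.carrier; Y.I, Y.carrier⟯) : X ⟶ Y := f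

theorem hom_ext {X Y : DiffMan} {f g : X ⟶ Y} (h : ∀ x, Hom.toMap f x = Hom.toMap g x) : f = g :=
  ContMDiffMap.ext h

theorem t2Space_tangentBundle (X : DiffMan) : T2Space (TangentBundle X.I X.carrier) := by
  refine ⟨fun p q hpq => ?_⟩
  by_cases hb : p.proj = q.proj
  · let e := trivializationAt X.E (TangentSpace X.I : X.carrier → Type) p.proj
    have hp : p ∈ e.source := by
      rw [e.mem_source]; exact FiberBundle.mem_baseSet_trivializationAt' p.proj
    have hq : q ∈ e.source := by
      rw [e.mem_source, ← hb]; exact FiberBundle.mem_baseSet_trivializationAt' p.proj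
    have hne : e p ≠ e q := fun h => hpq (e.injOn hp hq h)
    obtain ⟨U, V, hU, hV, hpU, hqV, hUV⟩ := t2_separation hne
    refine ⟨e.source ∩ e ⁻¹' U, e.source ∩ e ⁻¹' V,
      e.continuousOn.isOpen_inter_preimage e.open_source hU,
      e.continuousOn.isOpen_inter_preimage e.open_source hV, ⟨hp, hpU⟩, ⟨hq, hqV⟩, ?_⟩
    exact (hUV.preimage e).mono Set.inter_subset_right Set.inter_subset_right
  · obtain ⟨U, V, hU, hV, hpU, hqV, hUV⟩ := t2_separation hb
    have hc : Continuous (Bundle.TotalSpace.proj : TangentBundle X.I X.carrier → X.carrier) :=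
      FiberBundle.continuous_proj X.E (TangentSpace X.I : X.carrier → Type)
    exact ⟨_, _, hU.preimage hc, hV.preimage hc, hpU, hqV, hUV.preimage _⟩

theorem secondCountable_tangentBundle (X : DiffMan) :
    SecondCountableTopology (TangentBundle X.I X.carrier) := by
  have : SecondCountableTopology X.H := X.I.secondCountableTopology
  have : SecondCountableTopology (ModelProd X.H X.E) :=
    inferInstanceAs (SecondCountableTopology (X.H × X.E))
  obtain ⟨s, hs, hcov⟩ := TopologicalSpace.countable_cover_nhds
    (fun x : X.carrier => chart_source_mem_nhds X.H x)
  refine ChartedSpace.secondCountable_of_countable_cover (ModelProd X.H X.E)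
    (s := (fun x : X.carrier => (⟨x, 0⟩ : TangentBundle X.I X.carrier)) '' s) ?_ (hs.image _)
  refine Set.eq_univ_of_forall fun p => ?_
  have hp : p.proj ∈ ⋃ x ∈ s, (chartAt X.H x).source := hcov ▸ Set.mem_univ _
  simp only [Set.mem_iUnion, exists_prop] at hp
  obtain ⟨x, hx, hpx⟩ := hp
  simp only [Set.mem_iUnion, exists_prop]
  exact ⟨_, ⟨x, hx, rfl⟩, (TangentBundle.mem_chart_source_iff _ _).2 hpx⟩

/-- The tangent bundle of a manifold, as a manifold. -/
def tangentObj (X : DiffMan) : DiffMan :=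
  haveI := X.t2Space_tangentBundle
  haveI := X.secondCountable_tangentBundle
  { carrier := TangentBundle X.I X.carrier
    E := X.E × X.E
    H := ModelProd X.H X.E
    I := X.I.tangent }

/-- The tangent functor `X ↦ TX`, `f ↦ Tf` on smooth manifolds. -/
def tangent : DiffMan ⥤ DiffMan where
  obj := tangentObj
  map {X Y} f := ofMap (X := X.tangentObj) (Y := Y.tangentObj)
    ⟨tangentMap X.I Y.I (Hom.toMap f),
      (Hom.toMap f).contMDiff.contMDiff_tangentMap (by exact le_rfl)⟩
  map_id X := hom_ext fun p => congrFun (tangentMap_id (I := X.I) (M := X.carrier)) p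
  map_comp {X Y Z} f g := hom_ext fun p => congrFun (tangentMap_comp
    ((Hom.toMap g).contMDiff.mdifferentiable (by simp))
    ((Hom.toMap f).contMDiff.mdifferentiable (by simp))) p

theorem contMDiff_tangentProj (X : DiffMan) : ContMDiff X.I.tangent X.I ∞
    (Bundle.TotalSpace.proj : TangentBundle X.I X.carrier → X.carrier) :=
  Bundle.contMDiff_proj (TangentSpace X.I : X.carrier → Type)

/-- The canonical projection `p_X : TX ⟶ X`, natural in `X`. -/
def proj : tangent ⟶ 𝟭 DiffMan where
  app X := ofMap (X := X.tangentObj) (Y := X)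
    ⟨Bundle.TotalSpace.proj, X.contMDiff_tangentProj⟩
  naturality _ _ _ := rfl

end DiffMan

/-- The real spectrum of an `ℝ`-algebra: its `ℝ`-algebra homomorphisms to `ℝ`. -/
def RSpec (A : Type) [CommRing A] [Algebra ℝ A] : Type := A →ₐ[ℝ] ℝ

namespace RSpec

variable {A B : Type} [CommRing A] [Algebra ℝ A] [CommRing B] [Algebra ℝ B]

instance : FunLike (RSpec A) A ℝ := inferInstanceAs (FunLike (A →ₐ[ℝ] ℝ) A ℝ)

instance : AlgHomClass (RSpec A) ℝ A ℝ := inferInstanceAs (AlgHomClass (A →ₐ[ℝ] ℝ) ℝ A ℝ)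

/-- The initial topology with respect to all evaluation functions `p ↦ p a`. -/
instance : TopologicalSpace (RSpec A) :=
  TopologicalSpace.induced (fun p (a : A) => p a) inferInstance

theorem continuous_eval (a : A) : Continuous fun p : RSpec A => p a :=
  (continuous_apply a).comp continuous_induced_dom

/-- The functional representation `ρ : A → Top(Spec_ℝ A, ℝ)`, `ρ a p = p a`. -/
def rho (A : Type) [CommRing A] [Algebra ℝ A] : A →ₐ[ℝ] C(RSpec A, ℝ) where
  toFun a := ⟨fun p => p a, continuous_eval a⟩
  map_one' := by ext p; exact map_one p
  map_mul' a b := by ext p; exact map_mul p a b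
  map_zero' := by ext p; exact map_zero p
  map_add' a b := by ext p; exact map_add p a b
  commutes' r := by ext p; exact AlgHomClass.commutes p r

@[simp] theorem rho_apply (a : A) (p : RSpec A) : rho A a p = p a := rfl

/-- The map of spectra induced by an algebra homomorphism. -/
def comap (φ : A →ₐ[ℝ] B) : C(RSpec B, RSpec A) where
  toFun p := AlgHom.comp (show B →ₐ[ℝ] ℝ from p) φ
  continuous_toFun := continuous_induced_rng.2 (continuous_pi fun a => continuous_eval (φ a))

@[simp] theorem comap_apply (φ : A →ₐ[ℝ] B) (p : RSpec B) (a : A) : comap φ p a = p (φ a) := rfl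

end RSpec

/-- An `ℝ`-algebra is smooth if it is faithfully represented by functions on its real spectrum and
the algebra of these functions is closed under composition with smooth functions `ℝⁿ → ℝ`. -/
structure IsSmoothAlg (A : Type) [CommRing A] [Algebra ℝ A] : Prop where
  injective : Function.Injective (RSpec.rho A)
  closed : ∀ (n : ℕ) (f : (Fin n → ℝ) → ℝ), ContDiff ℝ ∞ f → ∀ a : Fin n → A,
    ∃ b : A, ⇑(RSpec.rho A b) = f ∘ fun p i => RSpec.rho A (a i) p

/-- The category of smooth algebras, a full subcategory of commutative `ℝ`-algebras. -/
abbrev SmAlg : Type 1 :=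
  ObjectProperty.FullSubcategory fun A : CommAlgCat.{0} ℝ => IsSmoothAlg A

/-- A real point of `C^∞(M)` commutes with smooth operations. -/
theorem RSpec.smooth_apply {E H M : Type} [NormedAddCommGroup E] [NormedSpace ℝ E]
    [TopologicalSpace H] {I : ModelWithCorners ℝ E H} [TopologicalSpace M] [ChartedSpace H M]
    (p : RSpec C^∞⟮I, M; ℝ⟯) {n : ℕ} (f : (Fin n → ℝ) → ℝ)
    (a : Fin n → C^∞⟮I, M; ℝ⟯) (b : C^∞⟮I, M; ℝ⟯) (hb : ∀ x, b x = f fun i => a i x) :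
    p b = f fun i => p (a i) := by
  let h : C^∞⟮I, M; ℝ⟯ := (b - algebraMap ℝ _ (p b)) ^ 2
    + ∑ i, (a i - algebraMap ℝ _ (p (a i))) ^ 2
  have hh : ∀ q : C^∞⟮I, M; ℝ⟯ →ₐ[ℝ] ℝ,
      q h = (q b - p b) ^ 2 + ∑ i, (q (a i) - p (a i)) ^ 2 := fun q => by
    simp only [h, map_add, map_pow, map_sub, map_sum, AlgHom.commutes, Algebra.algebraMap_self,
      RingHom.id_apply]
  have hp : p h = 0 := (hh p).trans (by
    have h0 : ∀ c, (show C^∞⟮I, M; ℝ⟯ →ₐ[ℝ] ℝ from p) c - p c = 0 := fun c => sub_self (p c)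
    simp [h0])
  obtain ⟨x, hx⟩ : ∃ x, h x = 0 := by
    by_contra! hne
    let k : C^∞⟮I, M; ℝ⟯ := ⟨fun x => (h x)⁻¹, fun x =>
      ((contDiffAt_inv ℝ (hne x)).contMDiffAt).comp x (h.contMDiff x)⟩
    have hk : h * k = 1 := by
      ext x
      exact mul_inv_cancel₀ (hne x)
    have := congrArg p hk
    rw [map_mul, hp, zero_mul, map_one] at this
    exact zero_ne_one this
  have hx' : (b x - p b) ^ 2 + ∑ i, (a i x - p (a i)) ^ 2 = 0 :=
    (hh ((Pi.evalAlgHom ℝ (fun _ : M => ℝ) x).comp ContMDiffMap.coeFnAlgHom)).symm.trans hx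
  have hs : 0 ≤ ∑ i, (a i x - p (a i)) ^ 2 := Finset.sum_nonneg fun i _ => sq_nonneg _
  have hb0 : (b x - p b) ^ 2 = 0 := by nlinarith [sq_nonneg (b x - p b)]
  have hs0 : ∑ i, (a i x - p (a i)) ^ 2 = 0 := by linarith
  have hbx : b x = p b := sub_eq_zero.1 (pow_eq_zero_iff two_ne_zero |>.1 hb0)
  have hax : ∀ i, a i x = p (a i) := fun i => sub_eq_zero.1 (pow_eq_zero_iff two_ne_zero |>.1
    ((Finset.sum_eq_zero_iff_of_nonneg fun i _ => sq_nonneg _).1 hs0 i (Finset.mem_univ i)))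
  rw [← hbx, hb]
  exact congrArg f (funext hax)

/-- Smooth operations performed on finitely many elements of `A`, as functions on the real
spectrum. They form the smooth completion of `A`. -/
def smoothCompletion (A : Type) [CommRing A] [Algebra ℝ A] : Subalgebra ℝ C(RSpec A, ℝ) where
  carrier := {g | ∃ (n : ℕ) (f : (Fin n → ℝ) → ℝ) (a : Fin n → A), ContDiff ℝ ∞ f ∧
    ⇑g = f ∘ fun p i => RSpec.rho A (a i) p}
  mul_mem' := by
    rintro g g' ⟨n, f, a, hf, hg⟩ ⟨n', f', a', hf', hg'⟩
    refine ⟨n + n', fun x => f (fun i => x (Fin.castAdd n' i)) * f' (fun i => x (Fin.natAdd n i)),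
      Fin.append a a', by fun_prop, ?_⟩
    ext p
    simp [hg, hg']
  add_mem' := by
    rintro g g' ⟨n, f, a, hf, hg⟩ ⟨n', f', a', hf', hg'⟩
    refine ⟨n + n', fun x => f (fun i => x (Fin.castAdd n' i)) + f' (fun i => x (Fin.natAdd n i)),
      Fin.append a a', by fun_prop, ?_⟩
    ext p
    simp [hg, hg']
  algebraMap_mem' r := ⟨0, fun _ => r, Fin.elim0, contDiff_const, rfl⟩

namespace smoothCompletion

variable {A B : Type} [CommRing A] [Algebra ℝ A] [CommRing B] [Algebra ℝ B]

/-- The element `f(a₁, …, aₙ)` of the smooth completion. -/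
def op {n : ℕ} (f : (Fin n → ℝ) → ℝ) (hf : ContDiff ℝ ∞ f) (a : Fin n → A) :
    smoothCompletion A :=
  ⟨⟨f ∘ fun p i => RSpec.rho A (a i) p, hf.continuous.comp
    (continuous_pi fun i => (RSpec.rho A (a i)).continuous)⟩, n, f, a, hf, rfl⟩

/-- The canonical homomorphism `A → Sm A`. -/
def unit (A : Type) [CommRing A] [Algebra ℝ A] : A →ₐ[ℝ] smoothCompletion A :=
  (RSpec.rho A).codRestrict _ fun a =>
    ⟨1, fun x => x 0, fun _ => a, contDiff_apply ℝ ℝ 0, rfl⟩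

@[simp] theorem unit_apply (a : A) (p : RSpec A) : (unit A a).1 p = p a := rfl

theorem spec_op {n : ℕ} (f : (Fin n → ℝ) → ℝ) (hf : ContDiff ℝ ∞ f) (a : Fin n → A)
    (p : RSpec (smoothCompletion A)) : p (op f hf a) = f fun i => p (unit A (a i)) := by
  let F : C^∞⟮𝓘(ℝ, Fin n → ℝ), Fin n → ℝ; ℝ⟯ →ₐ[ℝ] smoothCompletion A :=
    { toFun := fun g => op g g.contMDiff.contDiff a
      map_one' := rfl
      map_mul' := fun _ _ => rfl
      map_zero' := rfl
      map_add' := fun _ _ => rfl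
      commutes' := fun _ => rfl }
  exact RSpec.smooth_apply (RSpec.comap F p) f
    (fun i => ⟨fun y => y i, (contDiff_apply ℝ ℝ i).contMDiff⟩) ⟨f, hf.contMDiff⟩ fun _ => rfl

theorem exists_op (g : smoothCompletion A) :
    ∃ (n : ℕ) (f : (Fin n → ℝ) → ℝ) (hf : ContDiff ℝ ∞ f) (a : Fin n → A), g = op f hf a := by
  obtain ⟨g, n, f, a, hf, hg⟩ := g
  exact ⟨n, f, hf, a, Subtype.ext (DFunLike.coe_injective hg)⟩

/-- Every real point of `A` extends to `Sm A`. -/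
def point (p : RSpec A) : RSpec (smoothCompletion A) :=
  ((ContinuousMap.evalAlgHom ℝ ℝ p).comp (smoothCompletion A).val : smoothCompletion A →ₐ[ℝ] ℝ)

@[simp] theorem point_apply (p : RSpec A) (g : smoothCompletion A) : point p g = g.1 p := rfl

/-- The extension of a real point is unique. -/
theorem spec_eq (p : RSpec (smoothCompletion A)) (g : smoothCompletion A) :
    p g = g.1 (RSpec.comap (unit A) p) := by
  obtain ⟨n, f, hf, a, rfl⟩ := exists_op g
  rw [spec_op]; rfl

theorem isSmoothAlg (A : Type) [CommRing A] [Algebra ℝ A] : IsSmoothAlg (smoothCompletion A) where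
  injective g h hgh := Subtype.ext <| ContinuousMap.ext fun p =>
    congrArg (fun u : C(RSpec (smoothCompletion A), ℝ) => u (point p)) hgh
  closed n f hf g := by
    choose m f' hf' a hg using fun i => exists_op (g i)
    let e : (Σ i, Fin (m i)) ≃ Fin (∑ i, m i) := finSigmaFinEquiv
    refine ⟨op (fun y : Fin (∑ i, m i) → ℝ => f fun i => f' i fun j => y (e ⟨i, j⟩))
      (hf.comp (contDiff_pi.2 fun i => (hf' i).comp (contDiff_pi.2 fun j => contDiff_apply ℝ ℝ _)))
      (fun k => a (e.symm k).1 (e.symm k).2), ?_⟩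
    ext p
    have h : ∀ k : Σ i, Fin (m i), a (e.symm (e k)).1 (e.symm (e k)).2 = a k.1 k.2 := fun k => by
      rw [e.symm_apply_apply]
    simp only [RSpec.rho_apply, Function.comp_apply, spec_op, hg, h]

/-- Functoriality of the smooth completion. -/
def map (φ : A →ₐ[ℝ] B) : smoothCompletion A →ₐ[ℝ] smoothCompletion B :=
  ((ContinuousMap.compRightAlgHom ℝ ℝ (RSpec.comap φ)).comp (smoothCompletion A).val).codRestrict (smoothCompletion B)
    (by
      rintro ⟨g, n, f, a, hf, hg⟩
      refine ⟨n, f, fun i => φ (a i), hf, ?_⟩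
      ext p
      simp [hg])

@[simp] theorem map_apply (φ : A →ₐ[ℝ] B) (g : smoothCompletion A) (p : RSpec B) :
    (map φ g).1 p = g.1 (RSpec.comap φ p) := rfl

end smoothCompletion

/-- Smooth completion as a functor. -/
def Sm : CommAlgCat.{0} ℝ ⥤ SmAlg where
  obj A := ⟨CommAlgCat.of ℝ (smoothCompletion A), smoothCompletion.isSmoothAlg A⟩
  map φ := ObjectProperty.homMk (CommAlgCat.ofHom (smoothCompletion.map φ.hom))

/-- The inclusion of smooth algebras into commutative `ℝ`-algebras. -/
abbrev SmAlg.incl : SmAlg ⥤ CommAlgCat.{0} ℝ := ObjectProperty.ι _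

/-- A smooth algebra is isomorphic to its smooth completion. -/
def IsSmoothAlg.equiv {A : Type} [CommRing A] [Algebra ℝ A] (hA : IsSmoothAlg A) :
    A ≃ₐ[ℝ] smoothCompletion A :=
  AlgEquiv.ofBijective (smoothCompletion.unit A) ⟨fun a b h => hA.injective (congrArg Subtype.val h),
    by
      rintro ⟨g, n, f, a, hf, hg⟩
      obtain ⟨b, hb⟩ := hA.closed n f hf a
      exact ⟨b, Subtype.ext (DFunLike.coe_injective (hb.trans hg.symm))⟩⟩

/-- Smooth completion is left adjoint to the inclusion. -/
def smAdj : Sm ⊣ SmAlg.incl := Adjunction.mkOfUnitCounit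
  { unit :=
      { app := fun A => CommAlgCat.ofHom (smoothCompletion.unit A)
        naturality := fun _ _ _ => rfl }
    counit :=
      { app := fun A => ObjectProperty.homMk (CommAlgCat.ofHom A.property.equiv.symm.toAlgHom)
        naturality := fun A B φ => by
          ext g
          obtain ⟨a, rfl⟩ := A.property.equiv.surjective g
          apply B.property.equiv.injective
          refine (B.property.equiv.apply_symm_apply _).trans ?_
          refine Eq.trans ?_ (congrArg (fun u => B.property.equiv (φ.hom.hom u))
            (A.property.equiv.symm_apply_apply a).symm)
          rfl }
    left_triangle := by
      ext A g
      refine ((Sm.obj A).property.equiv.symm_apply_eq).2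
        (Subtype.ext (ContinuousMap.ext fun p => ?_))
      exact (smoothCompletion.spec_eq p g).symm
    right_triangle := by
      ext A a
      exact A.property.equiv.symm_apply_apply a }

/-- A symmetric partial differential algebra: a commutative `ℝ`-algebra graded by `ℕ`, with an
`ℝ`-linear differential `d` from degree `0` to degree `1` satisfying the Leibniz rule. -/
structure SymDiffAlg where
  /-- the underlying algebra -/
  carrier : Type
  [commRing : CommRing carrier]
  [algebra : Algebra ℝ carrier]
  /-- the homogeneous components -/
  deg : ℕ → Submodule ℝ carrier
  [graded : GradedAlgebra deg]
  /-- the differential -/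
  d : deg 0 →ₗ[ℝ] deg 1
  leibniz : ∀ a b : deg 0, (d (a * b) : carrier) = (a : carrier) * d b + (b : carrier) * d a

namespace SymDiffAlg

attribute [instance] commRing algebra graded

/-- Algebra homomorphisms of degree `0` respecting the differential. -/
@[ext]
structure Hom (A B : SymDiffAlg) where
  /-- the underlying algebra homomorphism -/
  toAlgHom : A.carrier →ₐ[ℝ] B.carrier
  map_deg : ∀ n, ∀ a ∈ A.deg n, toAlgHom a ∈ B.deg n
  map_d : ∀ a : A.deg 0, toAlgHom (A.d a) = B.d ⟨toAlgHom a, map_deg 0 a a.2⟩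

instance category : Category SymDiffAlg where
  Hom := Hom
  id A := ⟨AlgHom.id ℝ _, fun _ _ h => h, fun _ => rfl⟩
  comp f g := ⟨g.toAlgHom.comp f.toAlgHom, fun n a h => g.map_deg n _ (f.map_deg n a h),
    fun a => (congrArg g.toAlgHom (f.map_d a)).trans (g.map_d _)⟩

/-- The functor forgetting the differential and the grading. -/
def U : SymDiffAlg ⥤ CommAlgCat.{0} ℝ where
  obj A := CommAlgCat.of ℝ A.carrier
  map f := CommAlgCat.ofHom (Hom.toAlgHom f)

end SymDiffAlg

namespace SymDiff

section grading

variable (C M : Type) [CommRing C] [AddCommGroup M] [Module C M]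

open scoped DirectSum

/-- The homogeneous components of the symmetric algebra. -/
abbrev comp (n : ℕ) : Submodule C (SymmetricAlgebra C M) :=
  LinearMap.range (SymmetricAlgebra.ι C M) ^ n

instance : SetLike.GradedMonoid (comp C M) :=
  Submodule.nat_power_gradedMonoid (LinearMap.range (SymmetricAlgebra.ι C M))

/-- The inclusion of generators in degree `1`. -/
def gradedι : M →ₗ[C] ⨁ i : ℕ, comp C M i :=
  DirectSum.lof C ℕ (fun i => comp C M i) 1 ∘ₗ
    (SymmetricAlgebra.ι C M).codRestrict _ fun m => by
      simpa only [pow_one] using LinearMap.mem_range_self _ m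

theorem gradedι_apply (m : M) :
    gradedι C M m = DirectSum.of (fun i : ℕ => comp C M i) 1
      ⟨SymmetricAlgebra.ι C M m, by simpa only [pow_one] using LinearMap.mem_range_self _ m⟩ :=
  rfl

theorem lift_gradedι_eq (i : ℕ) (x : comp C M i) :
    SymmetricAlgebra.lift (gradedι C M) (x : SymmetricAlgebra C M)
      = DirectSum.of (fun i => comp C M i) i x := by
  obtain ⟨x, hx⟩ := x
  dsimp only [Subtype.coe_mk, DirectSum.lof_eq_of]
  induction hx using Submodule.pow_induction_on_left' with
  | algebraMap => simp_rw [AlgHom.commutes, DirectSum.algebraMap_apply]; rfl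
  | add _ _ _ _ _ ihx ihy => simp_rw [map_add, ihx, ihy, ← map_add]; rfl
  | mem_mul _ hm _ _ _ ih =>
      obtain ⟨_, rfl⟩ := hm
      simp_rw [map_mul, ih, SymmetricAlgebra.lift_ι_apply, gradedι_apply, DirectSum.of_mul_of]
      exact DirectSum.of_eq_of_gradedMonoid_eq (Sigma.subtype_ext (add_comm _ _) rfl)

instance gradedAlgebra : GradedAlgebra (comp C M) :=
  GradedAlgebra.ofAlgHom _ (SymmetricAlgebra.lift (gradedι C M))
    (by
      refine SymmetricAlgebra.algHom_ext (LinearMap.ext fun m => ?_)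
      change DirectSum.coeAlgHom (comp C M) (SymmetricAlgebra.lift (gradedι C M)
        (SymmetricAlgebra.ι C M m)) = SymmetricAlgebra.ι C M m
      rw [SymmetricAlgebra.lift_ι_apply, gradedι_apply, DirectSum.coeAlgHom_of, Subtype.coe_mk])
    (lift_gradedι_eq C M)

end grading

variable (C : Type) [CommRing C] [Algebra ℝ C]

/-- The symmetric algebra of the module of Kähler differentials of `C` over `ℝ`. -/
abbrev Sym : Type := SymmetricAlgebra C (Ω[C⁄ℝ])

/-- Its homogeneous components, as real vector spaces. -/
def deg (n : ℕ) : Submodule ℝ (Sym C) := (comp C (Ω[C⁄ℝ]) n).restrictScalars ℝ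

instance : GradedAlgebra (deg C) where
  one_mem := SetLike.GradedOne.one_mem (A := comp C (Ω[C⁄ℝ]))
  mul_mem _ _ _ _ ha hb := SetLike.GradedMul.mul_mem (A := comp C (Ω[C⁄ℝ])) ha hb
  decompose' := DirectSum.Decomposition.decompose' (ℳ := comp C (Ω[C⁄ℝ]))
  left_inv := DirectSum.Decomposition.left_inv (ℳ := comp C (Ω[C⁄ℝ]))
  right_inv := DirectSum.Decomposition.right_inv (ℳ := comp C (Ω[C⁄ℝ]))

variable {C}

/-- The element `dc` of degree `1`. -/
def diff : C →ₗ[ℝ] Sym C :=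
  (SymmetricAlgebra.ι C (Ω[C⁄ℝ])).restrictScalars ℝ ∘ₗ (KaehlerDifferential.D ℝ C).toLinearMap

theorem diff_mul (a b : C) : diff (a * b)
    = algebraMap C (Sym C) a * diff b + algebraMap C (Sym C) b * diff a := by
  simp [diff, Algebra.smul_def]

theorem diff_mem (c : C) : diff c ∈ deg C 1 := by
  change SymmetricAlgebra.ι C (Ω[C⁄ℝ]) _ ∈ LinearMap.range (SymmetricAlgebra.ι C (Ω[C⁄ℝ])) ^ 1
  rw [pow_one]
  exact LinearMap.mem_range_self _ _

theorem algebraMap_mem (c : C) : algebraMap C (Sym C) c ∈ deg C 0 := by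
  change _ ∈ LinearMap.range (SymmetricAlgebra.ι C (Ω[C⁄ℝ])) ^ 0
  rw [pow_zero]
  exact Submodule.algebraMap_mem c

/-- An element of degree `0` is an element of `C`. -/
theorem algebraMap_algebraMapInv {a : Sym C} (ha : a ∈ deg C 0) :
    algebraMap C (Sym C) (SymmetricAlgebra.algebraMapInv a) = a := by
  change _ ∈ LinearMap.range (SymmetricAlgebra.ι C (Ω[C⁄ℝ])) ^ 0 at ha
  rw [pow_zero] at ha
  obtain ⟨c, rfl⟩ := Submodule.mem_one.1 ha
  rw [SymmetricAlgebra.algebraMap_leftInverse]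

variable (C) in
/-- The differential `d : C → Ω`, on the part of degree `0`. -/
def dZero : deg C 0 →ₗ[ℝ] deg C 1 :=
  (diff.codRestrict (deg C 1) diff_mem) ∘ₗ
    (SymmetricAlgebra.algebraMapInv.restrictScalars ℝ).toLinearMap ∘ₗ (deg C 0).subtype

theorem coe_dZero (a : deg C 0) :
    (dZero C a : Sym C) = diff (SymmetricAlgebra.algebraMapInv (a : Sym C)) := rfl

theorem dZero_leibniz (a b : deg C 0) :
    (dZero C (a * b) : Sym C) = (a : Sym C) * dZero C b + (b : Sym C) * dZero C a := by
  simp only [coe_dZero, SetLike.GradeZero.coe_mul, map_mul, diff_mul,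
    algebraMap_algebraMapInv a.2, algebraMap_algebraMapInv b.2]

variable (C) in
/-- The symmetric algebra of the module of differentials, with `d : C → Ω` in degree `0`. -/
def obj : SymDiffAlg where
  carrier := Sym C
  deg := deg C
  d := dZero C
  leibniz := dZero_leibniz

section lift

variable {A : Type} [CommRing A] [Algebra ℝ A]

/-- The homomorphism out of `Sym C` given by an algebra homomorphism `φ : C → A` and an `ℝ`-linear
`δ : C → A` that is a derivation over `φ`; it sends `c` to `φ c` and `dc` to `δ c`. -/
def lift (φ : C →ₐ[ℝ] A) (δ : C →ₗ[ℝ] A)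
    (hδ : ∀ a b, δ (a * b) = φ a * δ b + φ b * δ a) : Sym C →ₐ[ℝ] A :=
  letI : Algebra C A := φ.toRingHom.toAlgebra
  haveI : IsScalarTower ℝ C A := IsScalarTower.of_algebraMap_eq fun r => (φ.commutes r).symm
  (SymmetricAlgebra.lift (Derivation.mk' δ fun a b => by
    rw [hδ]; rfl).liftKaehlerDifferential).restrictScalars ℝ

@[simp] theorem lift_algebraMap (φ : C →ₐ[ℝ] A) (δ : C →ₗ[ℝ] A)
    (hδ : ∀ a b, δ (a * b) = φ a * δ b + φ b * δ a) (c : C) :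
    lift φ δ hδ (algebraMap C (Sym C) c) = φ c := by
  let _ : Algebra C A := φ.toRingHom.toAlgebra
  exact AlgHom.commutes _ c

@[simp] theorem lift_diff (φ : C →ₐ[ℝ] A) (δ : C →ₗ[ℝ] A)
    (hδ : ∀ a b, δ (a * b) = φ a * δ b + φ b * δ a) (c : C) :
    lift φ δ hδ (diff c) = δ c := by
  let _ : Algebra C A := φ.toRingHom.toAlgebra
  have : IsScalarTower ℝ C A := IsScalarTower.of_algebraMap_eq fun r => (φ.commutes r).symm
  exact (SymmetricAlgebra.lift_ι_apply _ _).trans (Derivation.liftKaehlerDifferential_comp_D _ _)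

theorem hom_ext {f g : Sym C →ₐ[ℝ] A}
    (h₀ : ∀ c, f (algebraMap C (Sym C) c) = g (algebraMap C (Sym C) c))
    (h₁ : ∀ c, f (diff c) = g (diff c)) : f = g := by
  refine AlgHom.ext fun a => ?_
  induction a using SymmetricAlgebra.induction with
  | algebraMap c => exact h₀ c
  | ι x =>
    have hx : x ∈ Submodule.span C (Set.range (KaehlerDifferential.D ℝ C)) := by
      rw [KaehlerDifferential.span_range_derivation]; trivial
    induction hx using Submodule.span_induction with
    | mem x hx =>
      obtain ⟨c, rfl⟩ := hx
      exact h₁ c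
    | zero => simp
    | add x y _ _ hx hy => simp [hx, hy]
    | smul c x _ hx => rw [map_smul, Algebra.smul_def, map_mul, map_mul, h₀, hx]
  | mul a b ha hb => simp [ha, hb]
  | add a b ha hb => simp [ha, hb]

end lift

variable {D : Type} [CommRing D] [Algebra ℝ D]

/-- `Sym` on a homomorphism `h`: it sends `c` to `h c` and `dc` to `d(h c)`. -/
def mapAlg (h : C →ₐ[ℝ] D) : Sym C →ₐ[ℝ] Sym D :=
  lift ((IsScalarTower.toAlgHom ℝ D (Sym D)).comp h) (diff ∘ₗ h.toLinearMap)
    (fun a b => by simp [diff_mul])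

@[simp] theorem mapAlg_algebraMap (h : C →ₐ[ℝ] D) (c : C) :
    mapAlg h (algebraMap C (Sym C) c) = algebraMap D (Sym D) (h c) := lift_algebraMap _ _ _ c

@[simp] theorem mapAlg_diff (h : C →ₐ[ℝ] D) (c : C) : mapAlg h (diff c) = diff (h c) :=
  lift_diff _ _ _ c

theorem mapAlg_ι_mem (h : C →ₐ[ℝ] D) (x : Ω[C⁄ℝ]) :
    mapAlg h (SymmetricAlgebra.ι C (Ω[C⁄ℝ]) x)
      ∈ LinearMap.range (SymmetricAlgebra.ι D (Ω[D⁄ℝ])) := by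
  have hx : x ∈ Submodule.span C (Set.range (KaehlerDifferential.D ℝ C)) := by
    rw [KaehlerDifferential.span_range_derivation]; trivial
  induction hx using Submodule.span_induction with
  | mem x hx =>
    obtain ⟨c, rfl⟩ := hx
    rw [show SymmetricAlgebra.ι C (Ω[C⁄ℝ]) (KaehlerDifferential.D ℝ C c) = diff c from rfl,
      mapAlg_diff]
    exact LinearMap.mem_range_self _ _
  | zero => simp
  | add x y _ _ hx hy => rw [map_add, map_add]; exact add_mem hx hy
  | smul c x _ hx =>
    rw [map_smul, Algebra.smul_def, map_mul, mapAlg_algebraMap, ← Algebra.smul_def]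
    exact Submodule.smul_mem _ _ hx

theorem mapAlg_mem (h : C →ₐ[ℝ] D) (n : ℕ) (a : Sym C) (ha : a ∈ deg C n) :
    mapAlg h a ∈ deg D n := by
  change a ∈ LinearMap.range (SymmetricAlgebra.ι C (Ω[C⁄ℝ])) ^ n at ha
  change _ ∈ LinearMap.range (SymmetricAlgebra.ι D (Ω[D⁄ℝ])) ^ n
  induction ha using Submodule.pow_induction_on_left' with
  | algebraMap c =>
    rw [mapAlg_algebraMap, pow_zero]; exact Submodule.algebraMap_mem _
  | add x y i _ _ hx hy => rw [map_add]; exact add_mem hx hy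
  | mem_mul m hm i x _ hx =>
    obtain ⟨m, rfl⟩ := hm
    rw [map_mul, pow_succ']
    exact Submodule.mul_mem_mul (mapAlg_ι_mem h m) hx

theorem mapAlg_dZero (h : C →ₐ[ℝ] D) (a : deg C 0) :
    mapAlg h (dZero C a) = dZero D ⟨mapAlg h a, mapAlg_mem h 0 a a.2⟩ := by
  have hm : mapAlg h (a : Sym C) = algebraMap D (Sym D) (h (SymmetricAlgebra.algebraMapInv
      (a : Sym C))) := by
    rw [← mapAlg_algebraMap, algebraMap_algebraMapInv a.2]
  rw [coe_dZero, coe_dZero, mapAlg_diff]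
  simp only [hm, SymmetricAlgebra.algebraMap_leftInverse _ _]

/-- `Sym` on homomorphisms. -/
def map (h : C →ₐ[ℝ] D) : obj C ⟶ obj D :=
  { toAlgHom := mapAlg h
    map_deg := mapAlg_mem h
    map_d := mapAlg_dZero h : SymDiffAlg.Hom (obj C) (obj D) }

end SymDiff

/-- The functor `Sym`: the symmetric algebra over the module of differentials. -/
def SymF : CommAlgCat.{0} ℝ ⥤ SymDiffAlg where
  obj C := SymDiff.obj C
  map h := SymDiff.map h.hom
  map_id _ := SymDiffAlg.Hom.ext (SymDiff.hom_ext (fun c => SymDiff.mapAlg_algebraMap _ c)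
    (fun c => SymDiff.mapAlg_diff _ c))
  map_comp f g := SymDiffAlg.Hom.ext (SymDiff.hom_ext
    (fun c => (SymDiff.mapAlg_algebraMap _ c).trans ((congrArg (SymDiff.mapAlg g.hom)
      (SymDiff.mapAlg_algebraMap f.hom c)).trans (SymDiff.mapAlg_algebraMap _ _)).symm)
    (fun c => (SymDiff.mapAlg_diff _ c).trans ((congrArg (SymDiff.mapAlg g.hom)
      (SymDiff.mapAlg_diff f.hom c)).trans (SymDiff.mapAlg_diff _ _)).symm))

/-- The canonical homomorphism `C → Sym C` onto the part of degree `0`. -/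
def symInclusion : 𝟭 (CommAlgCat.{0} ℝ) ⟶ SymF ⋙ SymDiffAlg.U where
  app C := CommAlgCat.ofHom (IsScalarTower.toAlgHom ℝ C (SymDiff.Sym C))
  naturality _ _ h :=
    CommAlgCat.hom_ext (AlgHom.ext fun c => (SymDiff.mapAlg_algebraMap h.hom c).symm)

namespace DiffMan

theorem isSmoothAlg (X : DiffMan) : IsSmoothAlg C^∞⟮X.I, X.carrier; ℝ⟯ where
  injective a b h := ContMDiffMap.ext fun x => by
    let p : RSpec C^∞⟮X.I, X.carrier; ℝ⟯ :=
      (Pi.evalAlgHom ℝ (fun _ : X.carrier => ℝ) x).comp ContMDiffMap.coeFnAlgHom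
    exact congrArg (fun u : C(RSpec C^∞⟮X.I, X.carrier; ℝ⟯, ℝ) => u p) h
  closed n f hf a := ⟨⟨fun x => f fun i => a i x,
    hf.comp_contMDiff (contMDiff_pi_space.2 fun i => (a i).contMDiff)⟩,
    funext fun p => RSpec.smooth_apply p f a _ fun _ => rfl⟩

/-- The functor `X ↦ C^∞(X)`, `f ↦ (a ↦ a ∘ f)`. -/
def smoothFunctions : DiffManᵒᵖ ⥤ SmAlg where
  obj X := ⟨CommAlgCat.of ℝ C^∞⟮X.unop.I, X.unop.carrier; ℝ⟯, X.unop.isSmoothAlg⟩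
  map f := ObjectProperty.homMk (CommAlgCat.ofHom
    { toFun := fun a => a.comp (Hom.toMap f.unop)
      map_one' := rfl
      map_mul' := fun _ _ => rfl
      map_zero' := rfl
      map_add' := fun _ _ => rfl
      commutes' := fun _ => rfl })

end DiffMan

/-- The composite of the inclusion of smooth algebras, `Sym`, `U` and smooth completion. -/
def smTangent : SmAlg ⥤ SmAlg := SmAlg.incl ⋙ SymF ⋙ SymDiffAlg.U ⋙ Sm

/-- The canonical map `A → Sym A → Sm (Sym A)`, natural in the smooth algebra `A`. -/
def smTangentEmbedding : 𝟭 SmAlg ⟶ smTangent where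
  app A := ObjectProperty.homMk (symInclusion.app A.obj ≫ smAdj.unit.app _)
  naturality A B φ := by
    apply ObjectProperty.hom_ext
    exact (congrArg (· ≫ smAdj.unit.app _) (symInclusion.naturality φ.hom)).trans
      (congrArg (symInclusion.app A.obj ≫ ·) (smAdj.unit.naturality ((SymF ⋙ SymDiffAlg.U).map φ.hom)))

end

/-!
The isomorphism is the inverse of the homomorphism `Sm(Sym(C^∞(X))) → C^∞(TX)` that sends a function
`c` to `c ∘ p_X` and `dc` to the differential of `c`, a function on `TX` linear on the fibres.

It is injective because every real point of `Sym(C^∞(X))` is the evaluation at a tangent vector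
(`DiffMan.exists_comap_eval_eq`). Such a point consists of a real point of `C^∞(X)`, which is the
evaluation at a point `x` of `X` (`RSpec.exists_eq_eval`), and a derivation at `x`, which is a tangent
vector (`exists_tangentVector_of_leibniz`).

It is surjective because of an embedding `a : X → ℝᴺ` with closed image and smooth local left inverses
(`exists_isRetractEmbedding`): every smooth function on `TX` is a smooth function of finitely many
functions `aᵢ ∘ p_X` and `daᵢ` (`IsRetractEmbedding.exists_eq_comp_tangent`). As `X` need not be
compact, the finiteness of `N` rests on a cover of `X` by finitely many open sets that are disjoint
unions of chart domains (`exists_finite_chart_families`). It is obtained from a locally finite cover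
by bump functions, cut off at levels in general position, so that no more than `dim X` of the level
sets meet at a point.

The Kan extension property holds because a cocone on the manifolds `X` over `A`, that is, on the
morphisms `C^∞(X) ⟶ A`, amounts to a homomorphism `φ` on `A` and a derivation `δ` over `φ`, and so to a
homomorphism on `Sym(A)`: the values `φ a` and `δ a` are read off from the map `C^∞(ℝ) ⟶ A` sending
the coordinate to `a`, and the identities between them follow from the naturality of the cocone, since
any two elements of `A` lie in the image of a map `C^∞(ℝ²) ⟶ A`.
Finally, `i_A` is injective because every real point of `A` extends to `Sym(A)`.
-/

universe u

/-! ### Hadamard's lemma -/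

section Hadamard
open MeasureTheory Set Filter Topology

variable {F G : Type u} [NormedAddCommGroup F] [NormedSpace ℝ F] [FiniteDimensional ℝ F]
  [NormedAddCommGroup G] [NormedSpace ℝ G] [CompleteSpace G]

omit [CompleteSpace G] in
theorem hasFDerivAt_intervalIntegral_param {g : F × ℝ → G} (hg : ContDiff ℝ 1 g) (y : F) :
    HasFDerivAt (fun y => ∫ t in (0 : ℝ)..1, g (y, t))
      (∫ t in (0 : ℝ)..1, (fderiv ℝ g (y, t)).comp (ContinuousLinearMap.inl ℝ F ℝ)) y := by
  have hc : Continuous fun p : F × ℝ => (fderiv ℝ g p).comp (ContinuousLinearMap.inl ℝ F ℝ) :=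
    (hg.continuous_fderiv one_ne_zero).clm_comp continuous_const
  obtain ⟨C, hC⟩ := ((isCompact_closedBall y 1).prod
    (isCompact_Icc (a := (0 : ℝ)) (b := 1))).bddAbove_image hc.norm.continuousOn
  have hsec : ∀ z : F, Continuous fun t : ℝ => ((z, t) : F × ℝ) := fun z => by fun_prop
  refine intervalIntegral.hasFDerivAt_integral_of_dominated_of_fderiv_le
    (F := fun y t => g (y, t))
    (F' := fun y t => (fderiv ℝ g (y, t)).comp (ContinuousLinearMap.inl ℝ F ℝ))
    (bound := fun _ => C) (Metric.closedBall_mem_nhds y one_pos) ?_ ?_ ?_ ?_ ?_ ?_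
  · exact Eventually.of_forall fun z => (hg.continuous.comp (hsec z)).aestronglyMeasurable
  · exact (hg.continuous.comp (hsec y)).intervalIntegrable _ _
  · exact (hc.comp (hsec y)).aestronglyMeasurable
  · refine Eventually.of_forall fun t ht z hz => hC ⟨(z, t), ⟨hz, ?_⟩, rfl⟩
    rw [uIoc_of_le zero_le_one] at ht
    exact ⟨ht.1.le, ht.2⟩
  · exact intervalIntegrable_const
  · refine Eventually.of_forall fun t _ z _ => ?_
    have h1 : HasFDerivAt g (fderiv ℝ g (z, t)) (z, t) :=
      (hg.differentiable one_ne_zero _).hasFDerivAt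
    exact h1.comp z (hasFDerivAt_prodMk_left z t)

theorem contDiff_intervalIntegral_param_nat (n : ℕ) {G : Type u} [NormedAddCommGroup G]
    [NormedSpace ℝ G] [CompleteSpace G] {g : F × ℝ → G} (hg : ContDiff ℝ n g) :
    ContDiff ℝ n fun y => ∫ t in (0 : ℝ)..1, g (y, t) := by
  induction n generalizing G with
  | zero =>
    rw [Nat.cast_zero, contDiff_zero] at hg ⊢
    exact intervalIntegral.continuous_parametric_intervalIntegral_of_continuous' (by exact hg) 0 1
  | succ n ih =>
    rw [Nat.cast_succ]
    refine contDiff_succ_iff_hasFDerivAt.2 ⟨_, ih (G := F →L[ℝ] G) (g := fun p =>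
      (fderiv ℝ g p).comp (ContinuousLinearMap.inl ℝ F ℝ)) ?_, fun y =>
      hasFDerivAt_intervalIntegral_param (hg.of_le (by exact_mod_cast Nat.le_add_left 1 n)) y⟩
    exact (hg.fderiv_right (m := n) (by simp)).clm_comp contDiff_const

theorem contDiff_intervalIntegral_param {g : F × ℝ → G} (hg : ContDiff ℝ ∞ g) :
    ContDiff ℝ ∞ fun y => ∫ t in (0 : ℝ)..1, g (y, t) :=
  contDiff_infty.2 fun n => contDiff_intervalIntegral_param_nat n (contDiff_infty.1 hg n)

/-- **Hadamard's lemma**, with `A y = ∫₀¹ f'(q + t (y - q)) dt`. It is what makes a derivation at a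
point obey the chain rule for arbitrary smooth functions, and not only for polynomials. -/
theorem ContDiff.exists_hadamard {f : F → G} (hf : ContDiff ℝ ∞ f) (q : F) :
    ∃ A : F → F →L[ℝ] G, ContDiff ℝ ∞ A ∧ A q = fderiv ℝ f q ∧ ∀ y, f y = f q + A y (y - q) := by
  have hd : ContDiff ℝ ∞ fun p : F × ℝ => fderiv ℝ f (q + p.2 • (p.1 - q)) :=
    (hf.fderiv_right (m := ∞) (by simp)).comp (by fun_prop)
  refine ⟨_, contDiff_intervalIntegral_param hd, by simp, fun y => ?_⟩
  have hc : Continuous fun t : ℝ => fderiv ℝ f (q + t • (y - q)) :=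
    hd.continuous.comp (Continuous.prodMk_right y)
  have hderiv : ∀ t ∈ uIcc (0 : ℝ) 1, HasDerivAt (fun t : ℝ => f (q + t • (y - q)))
      (fderiv ℝ f (q + t • (y - q)) (y - q)) t := fun t _ => by
    have h1 : HasDerivAt (fun t : ℝ => q + t • (y - q)) (y - q) t := by
      simpa using ((hasDerivAt_id t).smul_const (y - q)).const_add q
    exact ((hf.differentiable (by simp)) _).hasFDerivAt.comp_hasDerivAt t h1
  have := intervalIntegral.integral_eq_sub_of_hasDerivAt hderiv
    ((hc.clm_apply continuous_const).intervalIntegrable _ _)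
  rw [← ContinuousLinearMap.intervalIntegral_apply (hc.intervalIntegrable _ _)] at this
  simp only [one_smul, zero_smul, add_zero, add_sub_cancel] at this
  simp [this]

end Hadamard

/-! ### Finitely many families of disjoint chart domains -/

section Colouring
open MeasureTheory Set Filter Topology

variable {E : Type*} [NormedAddCommGroup E] [NormedSpace ℝ E] [FiniteDimensional ℝ E]
  {H : Type*} [TopologicalSpace H] {I : ModelWithCorners ℝ E H} [I.Boundaryless]
  {M : Type u} [TopologicalSpace M] [ChartedSpace H M] [IsManifold I ∞ M]
  [SecondCountableTopology M]

omit [IsManifold I ∞ M] in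
/-- The easy case of Sard's theorem: the image of a smooth map into a space of larger dimension is
null, because smooth maps do not raise the Hausdorff dimension. -/
theorem volume_range_eq_zero_of_contMDiff {ι : Type*} [Fintype ι]
    (hι : Module.finrank ℝ E < Fintype.card ι) {f : M → ι → ℝ}
    (hf : ContMDiff I 𝓘(ℝ, ι → ℝ) ∞ f) : volume (range f) = 0 := by
  have hloc : ∀ x : M, ∃ V ∈ 𝓝 x, volume (f '' V) = 0 := by
    intro x
    have hg : ContDiffAt ℝ 1 (f ∘ (extChartAt I x).symm) (extChartAt I x x) := by
      have h := (contMDiffAt_iff.1 (hf x)).2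
      rw [I.range_eq_univ, contDiffWithinAt_univ] at h
      exact h.of_le (by simp)
    obtain ⟨K, t, ht, hK⟩ := hg.exists_lipschitzOnWith
    refine ⟨(extChartAt I x) ⁻¹' t ∩ (extChartAt I x).source, inter_mem
      ((continuousAt_extChartAt x).preimage_mem_nhds ht) (extChartAt_source_mem_nhds x), ?_⟩
    refine measure_mono_null (t := (f ∘ (extChartAt I x).symm) '' t) ?_ ?_
    · rintro _ ⟨y, ⟨hy, hys⟩, rfl⟩
      exact ⟨_, hy, congrArg f ((extChartAt I x).left_inv hys)⟩
    · rw [← hausdorffMeasure_pi_real]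
      have hd : dimH ((f ∘ (extChartAt I x).symm) '' t) < ((Fintype.card ι : NNReal) : ENNReal) :=
        calc _ ≤ dimH t := hK.dimH_image_le
          _ ≤ dimH (univ : Set E) := dimH_mono (subset_univ _)
          _ = Module.finrank ℝ E := Real.dimH_univ_eq_finrank E
          _ < _ := by exact_mod_cast hι
      have := hausdorffMeasure_of_dimH_lt hd
      simpa using this
  choose V hV hV0 using hloc
  obtain ⟨s, hs, hcov⟩ := TopologicalSpace.countable_cover_nhds hV
  rw [← image_univ, ← hcov, image_iUnion₂]
  exact (measure_biUnion_null_iff hs).2 fun x _ => hV0 x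

omit [IsManifold I ∞ M] in
/-- Levels `r i ∈ (0, 1)` in general position: at most `dim M` of the level sets `f i = r i` meet at a
point. Independent uniformly distributed levels have this property almost surely. -/
theorem exists_generic_levels {ι : Type*} [Countable ι] {f : ι → M → ℝ}
    (hf : ∀ i, ContMDiff I 𝓘(ℝ, ℝ) ∞ (f i)) :
    ∃ r : ι → ℝ, (∀ i, r i ∈ Ioo (0 : ℝ) 1) ∧
      ∀ S : Finset ι, Module.finrank ℝ E < S.card → ∀ x, ∃ i ∈ S, f i x ≠ r i := by
  let ν : Measure ℝ := volume.restrict (Ioo (0 : ℝ) 1)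
  have : IsProbabilityMeasure ν := ⟨by simp [ν]⟩
  let μ : Measure (ι → ℝ) := Measure.infinitePi fun _ => ν
  have h1 : ∀ᵐ r ∂μ, ∀ i, r i ∈ Ioo (0 : ℝ) 1 := by
    rw [ae_all_iff]
    intro i
    have hν : ∀ᵐ t ∂ν, t ∈ Ioo (0 : ℝ) 1 := ae_restrict_mem measurableSet_Ioo
    rw [← Measure.infinitePi_map_eval (fun _ : ι => ν) i] at hν
    exact ae_of_ae_map (measurable_pi_apply i).aemeasurable hν
  have h2 : ∀ᵐ r ∂μ, ∀ S : Finset ι, Module.finrank ℝ E < S.card → ∀ x, ∃ i ∈ S, f i x ≠ r i := by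
    rw [ae_all_iff]
    intro S
    by_cases hS : Module.finrank ℝ E < S.card
    swap
    · exact Eventually.of_forall fun r h => absurd h hS
    have hnull : volume (range fun (x : M) (i : S) => f i x) = 0 :=
      volume_range_eq_zero_of_contMDiff (I := I) (by simpa using hS)
        (contMDiff_pi_space.2 fun i => hf i)
    have hν : ∀ᵐ t ∂(Measure.pi fun _ : S => ν), t ∉ range fun (x : M) (i : S) => f i x := by
      rw [show (Measure.pi fun _ : S => ν) = volume.restrict (univ.pi fun _ => Ioo (0 : ℝ) 1) from
        (Measure.restrict_pi_pi _ _).symm]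
      exact ae_restrict_of_ae (measure_eq_zero_iff_ae_notMem.1 hnull)
    rw [← Measure.infinitePi_map_restrict (fun _ : ι => ν)] at hν
    filter_upwards [ae_of_ae_map (Finset.measurable_restrict S).aemeasurable hν] with r hr _ x
    by_contra! hx
    exact hr ⟨x, funext fun i => hx i i.2⟩
  obtain ⟨r, hr⟩ := (h1.and h2).exists
  exact ⟨r, hr.1, hr.2⟩

/-- A locally finite family of functions with at most `D` of them nonpositive at each point yields
open sets `W S`, indexed by finite sets of indices, that are disjoint for distinct `S` of the same
cardinality. Here `W S` consists of the points where the values `u i`, `i ∈ S`, are smaller than all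
the other values, and the cardinality of `S` serves as one of `D` colours. -/
theorem exists_disjoint_families {ι X : Type*} [TopologicalSpace X] (D : ℕ) {u : ι → X → ℝ}
    (hu : ∀ i, Continuous (u i)) (hfin : LocallyFinite fun i => {x | u i x < 1})
    (hcov : ∀ x, ∃ i, u i x ≤ 0)
    (hord : ∀ (S : Finset ι) (x), (∀ i ∈ S, u i x ≤ 0) → S.card ≤ D) :
    ∃ W : Finset ι → Set X, (∀ S, IsOpen (W S)) ∧ (∀ S, ∀ i ∈ S, ∀ x ∈ W S, u i x < 1) ∧
      (∀ S S', S.card = S'.card → (W S ∩ W S').Nonempty → S = S') ∧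
      ∀ x, ∃ S : Finset ι, S.Nonempty ∧ S.card ≤ D ∧ x ∈ W S := by
  classical
  refine ⟨fun S => {x | ∀ i ∈ S, u i x < 1 ∧ ∀ j ∉ S, u i x < u j x}, fun S => ?_,
    fun S i hi x hx => (hx i hi).1, ?_, fun x => ?_⟩
  · rw [isOpen_iff_mem_nhds]
    intro x hx
    obtain ⟨N, hN, hNf⟩ := hfin x
    have h1 : ∀ᶠ y in 𝓝 x, ∀ i ∈ S, u i y < 1 :=
      (Filter.eventually_all_finset S).2 fun i hi =>
        (hu i).continuousAt.eventually_lt_const (hx i hi).1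
    have h2 : ∀ᶠ y in 𝓝 x, ∀ i ∈ S, ∀ j ∈ hNf.toFinset, j ∉ S → u i y < u j y :=
      (Filter.eventually_all_finset S).2 fun i hi =>
        (Filter.eventually_all_finset _).2 fun j _ => by
          by_cases hj : j ∈ S
          · exact Eventually.of_forall fun y h => absurd hj h
          · exact ((hu i).continuousAt.eventually_lt (hu j).continuousAt
              ((hx i hi).2 j hj)).mono fun y h _ => h
    filter_upwards [h1, h2, hN] with y hy1 hy2 hyN i hi
    refine ⟨hy1 i hi, fun j hj => ?_⟩
    by_cases hjN : u j y < 1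
    · exact hy2 i hi j (hNf.mem_toFinset.2 ⟨y, hjN, hyN⟩) hj
    · exact (hy1 i hi).trans_le (not_lt.1 hjN)
  · rintro S S' hc ⟨x, hx, hx'⟩
    by_contra hne
    obtain ⟨i, hi, hi'⟩ := Finset.not_subset.1 fun h => hne (Finset.eq_of_subset_of_card_le h hc.ge)
    obtain ⟨j, hj, hj'⟩ := Finset.not_subset.1 fun h =>
      hne (Finset.eq_of_subset_of_card_le h hc.le).symm
    exact lt_asymm ((hx i hi).2 j hj') ((hx' j hj).2 i hi')
  · have hf : {i | u i x ≤ 0}.Finite := (hfin.point_finite x).subset fun i hi =>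
      show u i x < 1 from lt_of_le_of_lt hi one_pos
    refine ⟨hf.toFinset, ?_, hord _ x fun i hi => hf.mem_toFinset.1 hi, fun i hi => ?_⟩
    · obtain ⟨i, hi⟩ := hcov x
      exact ⟨i, hf.mem_toFinset.2 hi⟩
    · have hi0 : u i x ≤ 0 := hf.mem_toFinset.1 hi
      exact ⟨hi0.trans_lt one_pos, fun j hj => hi0.trans_lt
        (not_le.1 fun h => hj (hf.mem_toFinset.2 h))⟩


variable (I M) in
/-- A second countable manifold is covered by finitely many open sets, each of which is a disjoint
union of countably many open subsets of charts. The chart domains come from a locally finite family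
of bump functions `f j`; cutting them off at generic levels `r j` bounds by `dim M + 1` the number of
the closed sets `{f j ≥ r j} ∩ ⋂ i < j, {f i ≤ r i}` that contain a given point. -/
theorem exists_finite_chart_families [T2Space M] : ∃ (D : ℕ) (κ : Type u) (_ : Countable κ)
    (O : Fin D → κ → Set M), (∀ c k, IsOpen (O c k)) ∧
      (∀ c k, (O c k).Nonempty → ∃ z : M, O c k ⊆ (extChartAt I z).source) ∧
      (∀ c k k', (O c k ∩ O c k').Nonempty → k = k') ∧ ∀ x, ∃ c k, x ∈ O c k := by
  have : LocallyCompactSpace M := Manifold.locallyCompact_of_finiteDimensional I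
  obtain ⟨ι, f, -⟩ := SmoothBumpCovering.exists_isSubordinate I (isClosed_univ (X := M))
    (U := fun _ => univ) fun x _ => univ_mem
  have hne : ∀ i, (Function.support (f i)).Nonempty := fun i => by
    exact ⟨f.c i, by rw [Function.mem_support, (f i).eq_one]; exact one_ne_zero⟩
  have : Countable ι := by
    rw [← Set.countable_univ_iff]
    exact f.locallyFinite.countable_univ hne
  obtain ⟨e, he⟩ := exists_injective_nat ι
  obtain ⟨r, hr, hgen⟩ := exists_generic_levels (I := I) (f := fun i => f i)
    fun i => (f i).contMDiff
  have hfin : ∀ j, {i | e i < e j}.Finite := fun j => (Set.finite_lt_nat (e j)).preimage he.injOn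
  -- `u j` vanishes exactly on the part of `{f j ≥ r j}` where `f i ≤ r i` for all earlier `i`,
  -- and `u j < 1` forces `f j ≠ 0`.
  let u : ι → M → ℝ := fun j x =>
    max (1 - f j x / r j) 0 + ∑ i ∈ (hfin j).toFinset, max (f i x / r i - 1) 0
  have hcont : ∀ i, Continuous (f i) := fun i => (f i).continuous
  have hu : ∀ j, Continuous (u j) := fun j => by fun_prop
  have hs : ∀ j x, 0 ≤ ∑ i ∈ (hfin j).toFinset, max (f i x / r i - 1) 0 := fun j x =>
    Finset.sum_nonneg fun i _ => le_max_right _ _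
  have hu1 : ∀ j x, u j x < 1 → f j x ≠ 0 := fun j x h h0 => by
    have := hs j x
    simp only [u, h0, zero_div, sub_zero] at h
    have := le_max_left (1 : ℝ) 0
    linarith
  have hu0 : ∀ j x, u j x ≤ 0 ↔ r j ≤ f j x ∧ ∀ i, e i < e j → f i x ≤ r i := fun j x => by
    have h1 := le_max_right (1 - f j x / r j) 0
    have h2 := hs j x
    have h3 : u j x ≤ 0 ↔ max (1 - f j x / r j) 0 = 0 ∧
        ∑ i ∈ (hfin j).toFinset, max (f i x / r i - 1) 0 = 0 := by
      constructor
      · intro h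
        simp only [u] at h
        constructor <;> linarith
      · rintro ⟨h, h'⟩
        simp only [u]
        linarith
    rw [h3, Finset.sum_eq_zero_iff_of_nonneg fun i _ => le_max_right _ _]
    simp only [max_eq_right_iff, Set.Finite.mem_toFinset, mem_ofPred_eq, sub_nonpos,
      one_le_div (hr j).1, div_le_one (hr _).1]
  have hcov : ∀ x, ∃ i, u i x ≤ 0 := by
    intro x
    have hex : ∃ n, ∃ j, e j = n ∧ r j ≤ f j x := by
      obtain ⟨j, hj⟩ := f.eventuallyEq_one' x (mem_univ x)
      exact ⟨_, j, rfl, by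
        have : f j x = 1 := hj.self_of_nhds
        rw [this]; exact (hr j).2.le⟩
    classical
    obtain ⟨j, hj, hjr⟩ := Nat.find_spec hex
    refine ⟨j, (hu0 j x).2 ⟨hjr, fun i hi => ?_⟩⟩
    by_contra! h
    exact Nat.find_min hex (hj ▸ hi) ⟨i, rfl, h.le⟩
  have hord : ∀ (S : Finset ι) (x), (∀ i ∈ S, u i x ≤ 0) → S.card ≤ Module.finrank ℝ E + 1 := by
    intro S x hS
    classical
    by_contra! hlt
    -- All indices of `S` but the last one, `m`, satisfy `f i x = r i`, which is too many.
    obtain ⟨m, hm, hmax⟩ := S.exists_max_image e (Finset.card_pos.1 (by omega))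
    obtain ⟨i, hi, hne⟩ := hgen (S.erase m) (by rw [Finset.card_erase_of_mem hm]; omega) x
    obtain ⟨him, hiS⟩ := Finset.mem_erase.1 hi
    refine hne (le_antisymm (((hu0 m x).1 (hS m hm)).2 i ?_) ((hu0 i x).1 (hS i hiS)).1)
    exact lt_of_le_of_ne (hmax i hiS) fun h => him (he h)
  obtain ⟨W, hWo, hW1, hWd, hWc⟩ := exists_disjoint_families (Module.finrank ℝ E + 1) hu
    (f.locallyFinite.subset fun j x h => hu1 j x h) hcov hord
  refine ⟨Module.finrank ℝ E + 1, Finset ι, inferInstance,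
    fun c S => {x | S.card = c + 1 ∧ x ∈ W S}, fun c S => ?_, ?_, ?_, fun x => ?_⟩
  · by_cases h : S.card = c + 1 <;> simp [h, hWo]
  · rintro c S ⟨x, hc, hx⟩
    obtain ⟨i, hi⟩ : S.Nonempty := Finset.card_pos.1 (by omega)
    refine ⟨f.c i, fun y hy => by
      rw [extChartAt_source]; exact (f i).support_subset_source (hu1 i y (hW1 S i hi y hy.2))⟩
  · rintro c S S' ⟨x, hx, hx'⟩
    exact hWd S S' (hx.1.trans hx'.1.symm) ⟨x, hx.2, hx'.2⟩
  · obtain ⟨S, hSn, hSc, hx⟩ := hWc x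
    have := Finset.card_pos.2 hSn
    exact ⟨⟨S.card - 1, by omega⟩, S, by simp only; omega, hx⟩

end Colouring

/-! ### Closed embeddings into finite-dimensional spaces -/

section Embedding
open Set Filter Topology

variable {E : Type*} [NormedAddCommGroup E] [NormedSpace ℝ E]
  {H : Type*} [TopologicalSpace H] (I : ModelWithCorners ℝ E H)
  {M : Type*} [TopologicalSpace M] [ChartedSpace H M]
  {F F' : Type*} [NormedAddCommGroup F] [NormedSpace ℝ F]
  [NormedAddCommGroup F'] [NormedSpace ℝ F']

/-- A smooth map with closed image which has, near every point of the image, a smooth left inverse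
defined on an open subset of the target. -/
structure IsRetractEmbedding (a : M → F) : Prop where
  contMDiff : ContMDiff I 𝓘(ℝ, F) ∞ a
  isClosed_range : IsClosed (range a)
  exists_leftInverse : ∀ x, ∃ (U : Set F) (σ : F → M), IsOpen U ∧ a x ∈ U ∧
    ContMDiffOn 𝓘(ℝ, F) I ∞ σ U ∧ ∀ y, a y ∈ U → σ (a y) = y

variable {I}

theorem IsRetractEmbedding.comp_equiv {a : M → F} (ha : IsRetractEmbedding I a) (L : F ≃L[ℝ] F') :
    IsRetractEmbedding I (L ∘ a) where
  contMDiff := L.contDiff.contMDiff.comp ha.contMDiff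
  isClosed_range := by
    rw [range_comp]
    exact L.toHomeomorph.isClosedMap _ ha.isClosed_range
  exists_leftInverse x := by
    obtain ⟨U, σ, hU, hx, hσ, h⟩ := ha.exists_leftInverse x
    refine ⟨L.symm ⁻¹' U, σ ∘ L.symm, hU.preimage L.symm.continuous, by simpa using hx,
      hσ.comp L.symm.contDiff.contMDiff.contMDiffOn fun _ h => h, fun y hy => ?_⟩
    simpa using h y (by simpa using hy)

/-- The image of `a` is closed if the sublevel sets of some continuous function of `a` are relatively
compact. -/
theorem isClosed_range_of_isCompact_sublevel {X Y : Type*} [TopologicalSpace X]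
    [TopologicalSpace Y] [T2Space Y] {a : X → Y} (ha : Continuous a) {ρ : Y → ℝ}
    (hρ : Continuous ρ) (hK : ∀ R : ℝ, ∃ K, IsCompact K ∧ {x | ρ (a x) < R} ⊆ K) :
    IsClosed (range a) := by
  refine isClosed_of_closure_subset fun y hy => ?_
  obtain ⟨K, hKc, hK⟩ := hK (ρ y + 1)
  have hN : {z | ρ z < ρ y + 1} ∈ 𝓝 y := (isOpen_lt hρ continuous_const).mem_nhds
    (show ρ y < ρ y + 1 from lt_add_one _)
  have hy' : y ∈ closure (a '' K) := by
    rw [mem_closure_iff_nhds] at hy ⊢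
    intro t ht
    obtain ⟨_, ⟨hzt, hzN⟩, x, rfl⟩ := hy _ (inter_mem ht hN)
    exact ⟨a x, hzt, x, hK hzN, rfl⟩
  rw [(hKc.image ha).isClosed.closure_eq] at hy'
  exact image_subset_range _ _ hy'

variable [FiniteDimensional ℝ E] [I.Boundaryless] [IsManifold I ∞ M] [T2Space M]
  [SecondCountableTopology M]

omit [I.Boundaryless] in
variable (I M) in
/-- A smooth exhaustion function: its sublevel sets are relatively compact. -/
theorem exists_contMDiff_exhaustion : ∃ ρ : M → ℝ, ContMDiff I 𝓘(ℝ, ℝ) ∞ ρ ∧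
    ∀ R : ℝ, ∃ K, IsCompact K ∧ {x | ρ x < R} ⊆ K := by
  have : LocallyCompactSpace M := Manifold.locallyCompact_of_finiteDimensional I
  let K : CompactExhaustion M := default
  obtain ⟨ρ, hρ⟩ := exists_contMDiffMap_forall_mem_convex_of_local_const I (n := ⊤)
    (t := fun x => Ici (K.find x : ℝ)) (fun x => convex_Ici _) fun x => by
      refine ⟨(K.find x + 1 : ℕ), ?_⟩
      filter_upwards [mem_interior_iff_mem_nhds.1 (K.subset_interior_succ _ (K.mem_find x))]
        with y hy
      exact mem_Ici.2 (by exact_mod_cast K.mem_iff_find_le.1 hy)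
  refine ⟨ρ, ρ.contMDiff, fun R => ⟨K ⌈R⌉₊, K.isCompact _, fun x hx => ?_⟩⟩
  have h1 : (K.find x : ℝ) ≤ ρ x := hρ x
  exact K.mem_iff_find_le.2 (by exact_mod_cast (h1.trans hx.le).trans (Nat.le_ceil R))

variable (I M) in
/-- A weak form of the **Whitney embedding theorem** for manifolds that need not be compact. For each
of finitely many families `c` of disjoint chart domains, with a cut-off function `χ c`, the
embedding has the components `χ c`, `χ c` times an integer label `e k` of the chart domain, and
`χ c` times the chart; division by the first component recovers the other two. A further component
is an exhaustion function, which makes the image closed. -/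
theorem exists_isRetractEmbedding : ∃ (N : ℕ) (a : M → Fin N → ℝ), IsRetractEmbedding I a := by
  classical
  suffices h : ∃ (D : ℕ) (a : M → (Fin D → ℝ × ℝ × E) × ℝ), IsRetractEmbedding I a by
    obtain ⟨D, a, ha⟩ := h
    exact ⟨_, _, ha.comp_equiv (ContinuousLinearEquiv.ofFinrankEq
      (F := Fin (Module.finrank ℝ ((Fin D → ℝ × ℝ × E) × ℝ)) → ℝ) (by simp))⟩
  have : LocallyCompactSpace M := Manifold.locallyCompact_of_finiteDimensional I
  rcases isEmpty_or_nonempty M with hM | hM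
  · exact ⟨0, isEmptyElim, ⟨fun x => isEmptyElim x, by simp [range_eq_empty], isEmptyElim⟩⟩
  obtain ⟨D, κ, _, O, hO, hOz, hOd, hOc⟩ := exists_finite_chart_families I M
  choose! z hz using hOz
  obtain ⟨e, he⟩ := exists_injective_nat κ
  obtain ⟨χ, hχ⟩ := SmoothPartitionOfUnity.exists_isSubordinate I (isClosed_univ (X := M))
    (fun c => ⋃ k, O c k) (fun c => isOpen_iUnion (hO c)) fun x _ => by
      simpa only [mem_iUnion] using hOc x
  obtain ⟨ρ, hρ, hρK⟩ := exists_contMDiff_exhaustion I M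
  have hG : ∀ c, ∃ G : M → ℝ × ℝ × E, ∀ k, ∀ x ∈ O c k,
      G x = (1, (e k : ℝ), extChartAt I (z c k) x) := fun c => by
    refine ⟨fun x => if h : ∃ k, x ∈ O c k then
      (1, (e h.choose : ℝ), extChartAt I (z c h.choose) x) else 0, fun k x hx => ?_⟩
    have h : ∃ k, x ∈ O c k := ⟨k, hx⟩
    have hk : h.choose = k := hOd c _ _ ⟨x, h.choose_spec, hx⟩
    simp only [dif_pos h, hk]
  choose G hG using hG
  have hsrc : ∀ c k, O c k ⊆ (extChartAt I (z c k)).source := fun c k x hx => hz c k ⟨x, hx⟩ hx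
  have hGs : ∀ c k, ∀ x ∈ O c k, ContMDiffAt I 𝓘(ℝ, ℝ × ℝ × E) ∞ (G c) x := fun c k x hx => by
    have h1 : ContMDiffAt I 𝓘(ℝ, E) ∞ (extChartAt I (z c k)) x :=
      contMDiffAt_extChartAt' (by simpa using hsrc c k hx)
    have h2 : ContMDiffAt I 𝓘(ℝ, ℝ × ℝ × E) ∞
        (fun x => ((1 : ℝ), (e k : ℝ), extChartAt I (z c k) x)) x :=
      contMDiffAt_const.prodMk_space (contMDiffAt_const.prodMk_space h1)
    exact h2.congr_of_eventuallyEq (eventually_of_mem ((hO c k).mem_nhds hx) (hG c k))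
  let b : Fin D → M → ℝ × ℝ × E := fun c x => χ c x • G c x
  have hb : ∀ c, ContMDiff I 𝓘(ℝ, ℝ × ℝ × E) ∞ (b c) := fun c =>
    χ.contMDiff_smul fun x hx => by
      obtain ⟨k, hk⟩ := mem_iUnion.1 (hχ c hx)
      exact hGs c k x hk
  have hmem : ∀ c x, χ c x ≠ 0 → ∃ k, x ∈ O c k := fun c x h =>
    mem_iUnion.1 (hχ c (subset_tsupport _ h))
  have ha : ContMDiff I 𝓘(ℝ, (Fin D → ℝ × ℝ × E) × ℝ) ∞ fun x => (fun c => b c x, ρ x) :=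
    (contMDiff_pi_space.2 hb).prodMk_space hρ
  refine ⟨D, fun x => (fun c => b c x, ρ x), ha,
    isClosed_range_of_isCompact_sublevel ha.continuous continuous_snd hρK, fun x => ?_⟩
  obtain ⟨c, hc⟩ : ∃ c, χ c x ≠ 0 := by
    by_contra! h
    have := χ.sum_eq_one (mem_univ x)
    simp [h] at this
  obtain ⟨k, hk⟩ := hmem c x hc
  let V : Set ((Fin D → ℝ × ℝ × E) × ℝ) := {v | (v.1 c).1 ≠ 0}
  let g : (Fin D → ℝ × ℝ × E) × ℝ → ℝ × E := fun v => (v.1 c).1⁻¹ • (v.1 c).2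
  have hV : IsOpen V := isOpen_ne_fun (by fun_prop) continuous_const
  have hg : ContDiffOn ℝ ∞ g V := by
    have h1 : ContDiff ℝ ∞ fun v : (Fin D → ℝ × ℝ × E) × ℝ => v.1 c := by fun_prop
    exact (h1.fst.contDiffOn.inv fun v hv => hv).smul h1.snd.contDiffOn
  have hgb : ∀ k y, y ∈ O c k → χ c y ≠ 0 →
      g (fun c => b c y, ρ y) = ((e k : ℝ), extChartAt I (z c k) y) := fun k y hy h => by
    simp only [g, b, hG c k y hy, Prod.smul_mk, smul_eq_mul, mul_one]
    simp [h]
  -- The ball of radius `1` around `e k` contains no other label, so it singles out the chart.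
  have hU : IsOpen (V ∩ g ⁻¹' (Metric.ball (e k : ℝ) 1 ×ˢ (extChartAt I (z c k)).target)) :=
    hg.continuousOn.isOpen_inter_preimage hV
      (Metric.isOpen_ball.prod (isOpen_extChartAt_target _))
  have hxV : ∀ y, (fun c => b c y, ρ y) ∈ V → χ c y ≠ 0 := fun y hy h => by simp [V, b, h] at hy
  have hVx : (fun c => b c x, ρ x) ∈ V := by
    change (b c x).1 ≠ 0
    simp [b, hG c k x hk, hc]
  refine ⟨_, fun v => (extChartAt I (z c k)).symm (g v).2, hU, ⟨hVx, ?_⟩, ?_, ?_⟩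
  · rw [mem_preimage, hgb k x hk hc]
    exact ⟨Metric.mem_ball_self one_pos, (extChartAt I (z c k)).map_source (hsrc c k hk)⟩
  · exact (contMDiffOn_extChartAt_symm (z c k)).comp
      (hg.snd.contMDiffOn.mono inter_subset_left) fun v hv => hv.2.2
  · rintro y ⟨hyV, hy⟩
    have hcy := hxV y hyV
    obtain ⟨k', hk'⟩ := hmem c y hcy
    rw [mem_preimage, hgb k' y hk' hcy] at hy
    have hkk : k' = k := he <| by
      have h1 := hy.1
      rw [Metric.mem_ball, Nat.dist_cast_real, Nat.dist_eq] at h1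
      have h2 : |(e k' : ℤ) - e k| < 1 := by exact_mod_cast h1
      rw [Int.abs_lt_one_iff] at h2
      omega
    subst hkk
    simp only [hgb k' y hk' hcy]
    exact (extChartAt I (z c k')).left_inv (hsrc c k' hk')

end Embedding

/-! ### Smooth functions and tangent vectors through an embedding -/

section Factor
open Set Filter Topology

variable {E : Type*} [NormedAddCommGroup E] [NormedSpace ℝ E]
  {H : Type*} [TopologicalSpace H] {I : ModelWithCorners ℝ E H}
  {M : Type*} [TopologicalSpace M] [ChartedSpace H M] [IsManifold I ∞ M]
  {F : Type*} [NormedAddCommGroup F] [NormedSpace ℝ F]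

variable (F) in
theorem contMDiff_mk_tangentBundle_modelSpace : ContMDiff 𝓘(ℝ, F × F) 𝓘(ℝ, F).tangent ∞
    (fun q : F × F => (⟨q.1, q.2⟩ : TangentBundle 𝓘(ℝ, F) F)) := by
  have h : ContMDiff 𝓘(ℝ, F × F) (𝓘(ℝ, F).prod 𝓘(ℝ, F)) ∞ (id : F × F → F × F) :=
    contDiff_fst.contMDiff.prodMk contDiff_snd.contMDiff
  rw [chartedSpaceSelf_prod] at h
  exact (contMDiff_tangentBundleModelSpaceHomeomorph_symm (I := 𝓘(ℝ, F)) (n := ∞)).comp h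

theorem contMDiff_mfderiv_apply {c : M → F} (hc : ContMDiff I 𝓘(ℝ, F) ∞ c) :
    ContMDiff I.tangent 𝓘(ℝ, F) ∞
      (fun v : TangentBundle I M => (mfderiv I 𝓘(ℝ, F) c v.proj v.2 : F)) :=
  (contMDiff_snd_tangentBundle_modelSpace F 𝓘(ℝ, F) (n := ∞)).comp
    (hc.contMDiff_tangentMap (by exact le_rfl))

omit [IsManifold I ∞ M] in
theorem TangentBundle.mk_eq_of_eq {v : TangentBundle I M} {y : M} {w : E} (hy : y = v.proj)
    (hw : w = v.2) : (⟨y, w⟩ : TangentBundle I M) = v := by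
  subst hy hw; rfl

omit [IsManifold I ∞ M] in
/-- The tangent map of a local left inverse of `a` is a local left inverse of the tangent map. -/
theorem IsRetractEmbedding.tangentMap_leftInverse {a : M → F} (ha : IsRetractEmbedding I a)
    {U : Set F} {σ : F → M} (hU : IsOpen U) (hσ : ContMDiffOn 𝓘(ℝ, F) I ∞ σ U)
    (h : ∀ y, a y ∈ U → σ (a y) = y) (v : TangentBundle I M) (hv : a v.proj ∈ U) :
    tangentMapWithin 𝓘(ℝ, F) I σ U ⟨a v.proj, mfderiv I 𝓘(ℝ, F) a v.proj v.2⟩ = v := by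
  have hN : a ⁻¹' U ∈ 𝓝 v.proj := ha.contMDiff.continuous.continuousAt.preimage_mem_nhds
    (hU.mem_nhds hv)
  have hid : σ ∘ a =ᶠ[𝓝 v.proj] id := eventually_of_mem hN fun y hy => h y hy
  have h1 : MDifferentiableAt 𝓘(ℝ, F) I σ (a v.proj) :=
    (hσ.contMDiffAt (hU.mem_nhds hv)).mdifferentiableAt (by simp)
  have h2 : MDifferentiableAt I 𝓘(ℝ, F) a v.proj :=
    (ha.contMDiff v.proj).mdifferentiableAt (by simp)
  refine TangentBundle.mk_eq_of_eq (h _ hv) ?_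
  have h3 := mfderiv_comp v.proj h1 h2
  rw [hid.mfderiv_eq, mfderiv_id] at h3
  change mfderivWithin 𝓘(ℝ, F) I σ U (a v.proj) _ = _
  rw [mfderivWithin_of_isOpen hU hv]
  exact (congrArg (fun T : E →L[ℝ] E => T v.2) h3).symm

/-- Every smooth function on the tangent bundle is a smooth function of `a` and `da`. Locally it
factors through the tangent map of a left inverse of `a`; the local factorizations are glued by a
partition of unity on `F × F`. -/
theorem IsRetractEmbedding.exists_eq_comp_tangent [FiniteDimensional ℝ F] {a : M → F}
    (ha : IsRetractEmbedding I a) {h : TangentBundle I M → ℝ}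
    (hh : ContMDiff I.tangent 𝓘(ℝ, ℝ) ∞ h) :
    ∃ f : F × F → ℝ, ContDiff ℝ ∞ f ∧
      ∀ v, h v = f (a v.proj, mfderiv I 𝓘(ℝ, F) a v.proj v.2) := by
  -- The admissible values at `q`: one value on the image of the tangent map, any value elsewhere.
  let t : F × F → Set ℝ := fun q => {r | ∀ v : TangentBundle I M,
    (a v.proj, (mfderiv I 𝓘(ℝ, F) a v.proj v.2 : F)) = q → h v = r}
  have ht : ∀ q, Convex ℝ (t q) := by
    intro q r hr r' hr' s t _ _ hst v hv
    rw [← hr v hv, ← hr' v hv, ← add_smul, hst, one_smul]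
  have hloc : ∀ q, ∃ U ∈ 𝓝 q, ∃ g : F × F → ℝ, ContMDiffOn 𝓘(ℝ, F × F) 𝓘(ℝ, ℝ) ∞ g U ∧
      ∀ y ∈ U, g y ∈ t y := by
    rintro ⟨q, w⟩
    by_cases hq : q ∈ range a
    · obtain ⟨x, rfl⟩ := hq
      obtain ⟨U, σ, hU, hx, hσ, hl⟩ := ha.exists_leftInverse x
      refine ⟨Prod.fst ⁻¹' U, (hU.preimage continuous_fst).mem_nhds hx,
        fun q => h (tangentMapWithin 𝓘(ℝ, F) I σ U ⟨q.1, q.2⟩), ?_, ?_⟩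
      · refine hh.comp_contMDiffOn ?_
        exact (hσ.contMDiffOn_tangentMapWithin (by exact le_rfl) hU.uniqueMDiffOn).comp
          (contMDiff_mk_tangentBundle_modelSpace F).contMDiffOn fun q hq => hq
      · rintro ⟨q', w'⟩ hq' v hv
        obtain ⟨rfl, rfl⟩ := Prod.mk.inj hv
        simp only
        rw [ha.tangentMap_leftInverse hU hσ hl v hq']
    · refine ⟨Prod.fst ⁻¹' (range a)ᶜ, (ha.isClosed_range.isOpen_compl.preimage
        continuous_fst).mem_nhds hq, fun _ => 0, contMDiffOn_const, fun q' hq' v hv => ?_⟩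
      exact absurd ⟨v.proj, congrArg Prod.fst hv⟩ hq'
  obtain ⟨f, hf⟩ := exists_contMDiffMap_forall_mem_convex_of_local 𝓘(ℝ, F × F) (n := ⊤) ht hloc
  exact ⟨f, f.contMDiff.contDiff, fun v => hf _ v rfl⟩

theorem IsRetractEmbedding.exists_eq_comp [FiniteDimensional ℝ F] {a : M → F}
    (ha : IsRetractEmbedding I a) {h : M → ℝ} (hh : ContMDiff I 𝓘(ℝ, ℝ) ∞ h) :
    ∃ f : F → ℝ, ContDiff ℝ ∞ f ∧ ∀ x, h x = f (a x) := by
  obtain ⟨f, hf, hfa⟩ := ha.exists_eq_comp_tangent (h := fun v => h v.proj)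
    (hh.comp (Bundle.contMDiff_proj (TangentSpace I : M → Type _)))
  refine ⟨fun q => f (q, 0), by fun_prop, fun x => ?_⟩
  exact (hfa ⟨x, 0⟩).trans
    (congrArg (fun w : F => f (a x, w)) (map_zero (mfderiv I 𝓘(ℝ, F) a x)))

omit [IsManifold I ∞ M] in
/-- A smooth self-map `Φ` of the ambient space that fixes the image of `a` pointwise and near `a x`
is a retraction `a ∘ σ` to this image. -/
theorem IsRetractEmbedding.exists_retraction_germ [FiniteDimensional ℝ F] {a : M → F}
    (ha : IsRetractEmbedding I a) (x : M) : ∃ (Φ : F → F) (σ : F → M), ContDiff ℝ ∞ Φ ∧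
      ContMDiffAt 𝓘(ℝ, F) I ∞ σ (a x) ∧ σ (a x) = x ∧ (∀ y, Φ (a y) = a y) ∧
      Φ =ᶠ[𝓝 (a x)] a ∘ σ := by
  obtain ⟨U, σ, hU, hx, hσ, hl⟩ := ha.exists_leftInverse x
  obtain ⟨r, hr, hrU⟩ := Metric.nhds_basis_closedBall.mem_iff.1 (hU.mem_nhds hx)
  let θ : ContDiffBump (a x) := ⟨r / 2, r, half_pos hr, half_lt_self hr⟩
  have hθU : tsupport θ ⊆ U := by rw [θ.tsupport_eq]; exact hrU
  have hs : ContMDiff 𝓘(ℝ, F) 𝓘(ℝ, F) ∞ fun q => θ q • a (σ q) :=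
    contMDiff_of_tsupport fun q hq => by
      have hqU : q ∈ U := hθU (tsupport_smul_subset_left _ _ hq)
      exact θ.contDiff.contMDiff.contMDiffAt.smul
        (ha.contMDiff.contMDiffAt.comp q (hσ.contMDiffAt (hU.mem_nhds hqU)))
  refine ⟨fun q => θ q • a (σ q) + (1 - θ q) • q, σ,
    hs.contDiff.add ((contDiff_const.sub θ.contDiff).smul contDiff_id),
    hσ.contMDiffAt (hU.mem_nhds hx), hl x hx, fun y => ?_, ?_⟩
  · by_cases hy : a y ∈ U
    · simp only [hl y hy, ← add_smul, add_sub_cancel, one_smul]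
    · simp [image_eq_zero_of_notMem_tsupport fun h => hy (hθU h)]
  · filter_upwards [θ.eventuallyEq_one] with q hq
    simp [hq]

theorem exists_contDiff_of_notMem_isClosed [FiniteDimensional ℝ F] {s : Set F} (hs : IsClosed s)
    {q : F} (hq : q ∉ s) : ∃ f : F → ℝ, ContDiff ℝ ∞ f ∧ f q = 1 ∧ ∀ y ∈ s, f y = 0 := by
  obtain ⟨f, hfs, -, hf, -, hfq⟩ := exists_contDiff_tsupport_subset (n := ⊤)
    (hs.isOpen_compl.mem_nhds hq)
  exact ⟨f, hf, hfq, fun y hy => image_eq_zero_of_notMem_tsupport fun h => hfs h hy⟩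

end Factor

/-! ### Real points and derivations of the algebra of smooth functions -/

section Points
open Set Filter Topology

variable {E H M : Type} [NormedAddCommGroup E] [NormedSpace ℝ E]
  [TopologicalSpace H] {I : ModelWithCorners ℝ E H} [TopologicalSpace M] [ChartedSpace H M]
  {N : ℕ}

/-- **Milnor's exercise**: the real points of `C^∞(M)` are the evaluations at points of `M`. -/
theorem RSpec.exists_eq_eval [IsManifold I ∞ M] {a : M → Fin N → ℝ} (ha : IsRetractEmbedding I a)
    (p : RSpec C^∞⟮I, M; ℝ⟯) : ∃ x, ∀ c, p c = c x := by
  let α : Fin N → C^∞⟮I, M; ℝ⟯ := fun i => ⟨fun x => a x i, contMDiff_pi_space.1 ha.contMDiff i⟩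
  have hq : (fun i => p (α i)) ∈ range a := by
    by_contra hq
    obtain ⟨f, hf, hf1, hf0⟩ := exists_contDiff_of_notMem_isClosed ha.isClosed_range hq
    have := RSpec.smooth_apply p f α 0 fun x => (hf0 _ ⟨x, rfl⟩).symm
    rw [hf1, map_zero] at this
    exact zero_ne_one this
  obtain ⟨x, hx⟩ := hq
  refine ⟨x, fun c => ?_⟩
  obtain ⟨f, hf, hc⟩ := ha.exists_eq_comp c.contMDiff
  rw [RSpec.smooth_apply p f α c hc, hc, ← hx]

/-- The chain rule for a derivation `δ` of `C^∞(M)` at a point `x`. -/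
theorem apply_eq_fderiv_of_leibniz {a : M → Fin N → ℝ} (ha : ContMDiff I 𝓘(ℝ, Fin N → ℝ) ∞ a)
    {x : M} {δ : C^∞⟮I, M; ℝ⟯ →ₗ[ℝ] ℝ} (hδ : ∀ b c, δ (b * c) = b x * δ c + c x * δ b)
    {f : (Fin N → ℝ) → ℝ} (hf : ContDiff ℝ ∞ f) (b : C^∞⟮I, M; ℝ⟯) (hb : ∀ y, b y = f (a y)) :
    δ b = fderiv ℝ f (a x) fun i => δ ⟨fun y => a y i, contMDiff_pi_space.1 ha i⟩ := by
  classical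
  obtain ⟨A, hA, hAq, hAf⟩ := hf.exists_hadamard (a x)
  let α : Fin N → C^∞⟮I, M; ℝ⟯ := fun i => ⟨fun x => a x i, contMDiff_pi_space.1 ha i⟩
  let β : Fin N → C^∞⟮I, M; ℝ⟯ := fun i => ⟨fun y => A (a y) (Pi.single i 1),
    (hA.clm_apply contDiff_const).contMDiff.comp ha⟩
  have h1 : δ 1 = 0 := by
    have := hδ 1 1
    simp only [mul_one, ContMDiffMap.coe_one, Pi.one_apply, one_mul] at this
    linarith
  have hconst : ∀ r : ℝ, δ (algebraMap ℝ _ r) = 0 := fun r => by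
    rw [Algebra.algebraMap_eq_smul_one, map_smul, h1, smul_zero]
  have hsum : ∀ (T : (Fin N → ℝ) →L[ℝ] ℝ) (w : Fin N → ℝ), T w = ∑ i, w i * T (Pi.single i 1) :=
    fun T w => by
      conv_lhs => rw [pi_eq_sum_univ' w, map_sum]
      exact Finset.sum_congr rfl fun i _ => by rw [map_smul, smul_eq_mul]
  have hb' : b = algebraMap ℝ _ (f (a x)) + ∑ i, (α i - algebraMap ℝ _ (a x i)) * β i := by
    ext y
    have : (∑ i, (α i - algebraMap ℝ _ (a x i)) * β i : C^∞⟮I, M; ℝ⟯) y =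
        ∑ i, (a y i - a x i) * A (a y) (Pi.single i 1) :=
      map_sum ((Pi.evalAlgHom ℝ (fun _ : M => ℝ) y).comp ContMDiffMap.coeFnAlgHom) _ _
    rw [hb, hAf, hsum]
    exact congrArg (f (a x) + ·) this.symm
  rw [hb', map_add, hconst, zero_add, map_sum, hsum, ← hAq]
  refine Finset.sum_congr rfl fun i _ => ?_
  rw [hδ, map_sub, hconst, sub_zero]
  have h0 : (α i - algebraMap ℝ _ (a x i) : C^∞⟮I, M; ℝ⟯) x = 0 := sub_self (a x i)
  rw [h0, zero_mul, zero_add, mul_comm]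
  rfl

/-- Every derivation `δ` of `C^∞(M)` at `x` is the derivative along a tangent vector. With `ξ = δ a`,
the chain rule for `Φ ∘ a = a` shows that `ξ` is fixed by the derivative of the retraction `Φ`; it is
therefore the image under `da` of a tangent vector. -/
theorem exists_tangentVector_of_leibniz [IsManifold I ∞ M] {a : M → Fin N → ℝ}
    (ha : IsRetractEmbedding I a)
    {x : M} {δ : C^∞⟮I, M; ℝ⟯ →ₗ[ℝ] ℝ} (hδ : ∀ b c, δ (b * c) = b x * δ c + c x * δ b) :
    ∃ w : TangentSpace I x, ∀ c : C^∞⟮I, M; ℝ⟯, δ c = mfderiv I 𝓘(ℝ, ℝ) c x w := by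
  let ξ : Fin N → ℝ := fun i => δ ⟨fun y => a y i, contMDiff_pi_space.1 ha.contMDiff i⟩
  obtain ⟨Φ, σ, hΦ, hσ, hσx, hΦa, hΦσ⟩ := ha.exists_retraction_germ x
  have hax : MDifferentiableAt I 𝓘(ℝ, Fin N → ℝ) a x :=
    (ha.contMDiff x).mdifferentiableAt (by simp)
  have hΦξ : fderiv ℝ Φ (a x) ξ = ξ := by
    ext i
    have h := apply_eq_fderiv_of_leibniz ha.contMDiff hδ (f := fun q => Φ q i)
      ((contDiff_apply ℝ ℝ i).comp hΦ)
      ⟨fun y => a y i, contMDiff_pi_space.1 ha.contMDiff i⟩ fun y => (congrFun (hΦa y) i).symm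
    rw [(hasFDerivAt_pi'.1 (hΦ.differentiable (by simp) (a x)).hasFDerivAt i).fderiv] at h
    exact h.symm
  let w : TangentSpace I (σ (a x)) := mfderiv 𝓘(ℝ, Fin N → ℝ) I σ (a x) ξ
  have hw : mfderiv I 𝓘(ℝ, Fin N → ℝ) a (σ (a x)) w = ξ := by
    have h := mfderiv_comp (a x) (I := 𝓘(ℝ, Fin N → ℝ)) (I' := I) (I'' := 𝓘(ℝ, Fin N → ℝ))
      (g := a) (f := σ) (by rw [hσx]; exact hax) (hσ.mdifferentiableAt (by simp))
    rw [← hΦσ.mfderiv_eq, mfderiv_eq_fderiv] at h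
    exact (congrArg (fun T : (Fin N → ℝ) →L[ℝ] (Fin N → ℝ) => T ξ) h).symm.trans hΦξ
  have key : ∃ w : TangentSpace I (σ (a x)), mfderiv I 𝓘(ℝ, Fin N → ℝ) a (σ (a x)) w = ξ := ⟨w, hw⟩
  rw [hσx] at key
  obtain ⟨w, hw⟩ := key
  refine ⟨w, fun c => ?_⟩
  obtain ⟨f, hf, hc⟩ := ha.exists_eq_comp c.contMDiff
  rw [apply_eq_fderiv_of_leibniz ha.contMDiff hδ hf c hc]
  have hcf : (c : M → ℝ) = f ∘ a := funext hc
  rw [hcf, mfderiv_comp x (hf.differentiable (by simp) _).mdifferentiableAt hax, mfderiv_eq_fderiv]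
  exact congrArg (fderiv ℝ f (a x)) hw.symm

end Points

/-! ### Homomorphisms out of the smooth completion -/

section SmoothCompletionLift

variable {A B : Type} [CommRing A] [Algebra ℝ A] [CommRing B] [Algebra ℝ B]

theorem IsSmoothAlg.ext (hB : IsSmoothAlg B) {a b : B} (h : ∀ q : RSpec B, q a = q b) : a = b :=
  hB.injective (ContinuousMap.ext h)

/-- Homomorphisms from `Sm A` to a smooth algebra are determined on `A`, because they respect the
smooth operations. -/
theorem smoothCompletion.algHom_ext (hB : IsSmoothAlg B) {φ ψ : smoothCompletion A →ₐ[ℝ] B}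
    (h : ∀ a, φ (unit A a) = ψ (unit A a)) : φ = ψ := by
  refine AlgHom.ext fun g => hB.ext fun q => ?_
  have h1 := smoothCompletion.spec_eq (RSpec.comap φ q) g
  have h2 := smoothCompletion.spec_eq (RSpec.comap ψ q) g
  have h3 : RSpec.comap (unit A) (RSpec.comap φ q) = RSpec.comap (unit A) (RSpec.comap ψ q) :=
    AlgHom.ext fun a => congrArg q (h a)
  rw [h3] at h1
  exact h1.trans h2.symm

/-- The extension of a homomorphism from `A` to a smooth algebra to the smooth completion. -/
noncomputable def smoothCompletion.lift (hB : IsSmoothAlg B) (f : A →ₐ[ℝ] B) :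
    smoothCompletion A →ₐ[ℝ] B :=
  hB.equiv.symm.toAlgHom.comp (smoothCompletion.map f)

@[simp] theorem smoothCompletion.lift_unit (hB : IsSmoothAlg B) (f : A →ₐ[ℝ] B) (a : A) :
    lift hB f (unit A a) = f a :=
  (hB.equiv.symm_apply_eq).2 rfl

theorem smoothCompletion.apply_lift (hB : IsSmoothAlg B) (f : A →ₐ[ℝ] B) (g : smoothCompletion A)
    (q : RSpec B) : q (lift hB f g) = g.1 (RSpec.comap f q) := by
  refine (smoothCompletion.spec_eq (RSpec.comap (lift hB f) q) g).trans (congrArg g.1 ?_)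
  exact AlgHom.ext fun a => congrArg q (lift_unit hB f a)

end SmoothCompletionLift

/-! ### The isomorphism between `Sm (Sym C^∞(X))` and `C^∞(TX)` -/

namespace DiffMan

/-- The algebra `C^∞(X)` of smooth functions. -/
abbrev Fun (X : DiffMan) : Type := C^∞⟮X.I, X.carrier; ℝ⟯

/-- The real point of `C^∞(X)` given by evaluation at a point of `X`. -/
noncomputable def eval (X : DiffMan) (x : X.carrier) : RSpec X.Fun :=
  (Pi.evalAlgHom ℝ (fun _ : X.carrier => ℝ) x).comp ContMDiffMap.coeFnAlgHom

theorem mdifferentiableAt (X : DiffMan) (c : X.Fun) (x : X.carrier) :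
    MDifferentiableAt X.I 𝓘(ℝ, ℝ) c x := (c.contMDiff x).mdifferentiableAt (by simp)

/-- The pull-back of functions along the projection `TX → X`. -/
noncomputable def pullProj (X : DiffMan) : X.Fun →ₐ[ℝ] X.tangentObj.Fun :=
  (smoothFunctions.map (proj.app X).op).hom.hom

/-- The differential of a function on `X`, as a function on `TX` that is linear on the fibres. -/
noncomputable def differential (X : DiffMan) : X.Fun →ₗ[ℝ] X.tangentObj.Fun where
  toFun c := ⟨fun v : TangentBundle X.I X.carrier => (mfderiv X.I 𝓘(ℝ, ℝ) c v.proj v.2 : ℝ),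
    contMDiff_mfderiv_apply c.contMDiff⟩
  map_add' b c := ContMDiffMap.ext fun v => by
    let v : TangentBundle X.I X.carrier := v
    exact congrArg (fun T : X.E →L[ℝ] ℝ => T v.2)
      (mfderiv_add (X.mdifferentiableAt b v.proj) (X.mdifferentiableAt c v.proj))
  map_smul' r c := ContMDiffMap.ext fun v => by
    let v : TangentBundle X.I X.carrier := v
    exact congrArg (fun T : X.E →L[ℝ] ℝ => T v.2)
      (const_smul_mfderiv (X.mdifferentiableAt c v.proj) r)

theorem differential_mul (X : DiffMan) (b c : X.Fun) : X.differential (b * c) =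
    X.pullProj b * X.differential c + X.pullProj c * X.differential b :=
  ContMDiffMap.ext fun v => by
    let v : TangentBundle X.I X.carrier := v
    exact congrArg (fun T : X.E →L[ℝ] ℝ => T v.2)
      ((X.mdifferentiableAt b v.proj).hasMFDerivAt.mul
        (X.mdifferentiableAt c v.proj).hasMFDerivAt).mfderiv

/-- The homomorphism `Sym(C^∞(X)) → C^∞(TX)` that sends `c` to `c ∘ p_X` and `dc` to the differential
of `c`. -/
noncomputable def symToTangent (X : DiffMan) : SymDiff.Sym X.Fun →ₐ[ℝ] X.tangentObj.Fun :=
  SymDiff.lift X.pullProj X.differential X.differential_mul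

/-- The extension of `symToTangent` to the smooth completion. -/
noncomputable def completionToTangent (X : DiffMan) :
    smoothCompletion (SymDiff.Sym X.Fun) →ₐ[ℝ] X.tangentObj.Fun :=
  smoothCompletion.lift X.tangentObj.isSmoothAlg X.symToTangent

/-- A real point of `Sym(C^∞(X))` is a point `x` of `X` together with a derivation at `x`, that is, a
tangent vector. -/
theorem exists_comap_eval_eq (X : DiffMan) (r : RSpec (SymDiff.Sym X.Fun)) :
    ∃ v, RSpec.comap X.symToTangent (X.tangentObj.eval v) = r := by
  obtain ⟨N, a, ha⟩ := exists_isRetractEmbedding X.I X.carrier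
  let p : RSpec X.Fun := RSpec.comap (IsScalarTower.toAlgHom ℝ X.Fun (SymDiff.Sym X.Fun)) r
  obtain ⟨x, hx⟩ := RSpec.exists_eq_eval ha p
  let δ : X.Fun →ₗ[ℝ] ℝ := (show SymDiff.Sym X.Fun →ₐ[ℝ] ℝ from r).toLinearMap ∘ₗ SymDiff.diff
  obtain ⟨w, hw⟩ := exists_tangentVector_of_leibniz ha (x := x) (δ := δ) fun b c => by
    have h1 : r (SymDiff.diff (b * c)) = p b * r (SymDiff.diff c) + p c * r (SymDiff.diff b) := by
      rw [SymDiff.diff_mul, map_add, map_mul, map_mul]; rfl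
    rw [hx, hx] at h1
    exact h1
  refine ⟨(⟨x, w⟩ : TangentBundle X.I X.carrier), SymDiff.hom_ext (fun c => ?_) fun c => ?_⟩
  · exact (congrArg (X.tangentObj.eval (⟨x, w⟩ : TangentBundle X.I X.carrier))
      (SymDiff.lift_algebraMap _ _ X.differential_mul c)).trans (hx c).symm
  · exact (congrArg (X.tangentObj.eval (⟨x, w⟩ : TangentBundle X.I X.carrier))
      (SymDiff.lift_diff _ _ X.differential_mul c)).trans (hw c).symm

theorem completionToTangent_injective (X : DiffMan) :
    Function.Injective X.completionToTangent := fun g g' h =>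
  Subtype.ext <| ContinuousMap.ext fun r => by
    obtain ⟨v, rfl⟩ := X.exists_comap_eval_eq r
    have := congrArg (X.tangentObj.eval v) h
    rwa [completionToTangent, smoothCompletion.apply_lift, smoothCompletion.apply_lift] at this

theorem completionToTangent_surjective (X : DiffMan) :
    Function.Surjective X.completionToTangent := fun h => by
  obtain ⟨N, a, ha⟩ := exists_isRetractEmbedding X.I X.carrier
  obtain ⟨f, hf, hfa⟩ := ha.exists_eq_comp_tangent (h := h) h.contMDiff
  let α : Fin N → X.Fun := fun i => ⟨fun x => a x i, contMDiff_pi_space.1 ha.contMDiff i⟩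
  refine ⟨smoothCompletion.op (n := N + N)
    (fun y => f (fun i => y (Fin.castAdd N i), fun i => y (Fin.natAdd N i))) (by fun_prop)
    (Fin.append (fun i => algebraMap _ (SymDiff.Sym X.Fun) (α i)) fun i => SymDiff.diff (α i)),
    ContMDiffMap.ext fun v => ?_⟩
  let v : TangentBundle X.I X.carrier := v
  refine (smoothCompletion.apply_lift X.tangentObj.isSmoothAlg X.symToTangent _
    (X.tangentObj.eval v)).trans ?_
  refine Eq.trans ?_ (hfa v).symm
  change f (_, _) = _
  have hax : MDifferentiableAt X.I 𝓘(ℝ, Fin N → ℝ) a v.proj :=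
    (ha.contMDiff v.proj).mdifferentiableAt (by simp)
  congr 2
  · funext i
    simp only [RSpec.rho_apply, Fin.append_left, RSpec.comap_apply, symToTangent,
      SymDiff.lift_algebraMap]
    rfl
  · funext i
    simp only [RSpec.rho_apply, Fin.append_right, RSpec.comap_apply, symToTangent,
      SymDiff.lift_diff]
    change (mfderiv X.I 𝓘(ℝ, ℝ) (fun x => a x i) v.proj v.2 : ℝ) = _
    have h1 := mfderiv_comp (I := X.I) (I' := 𝓘(ℝ, Fin N → ℝ)) (I'' := 𝓘(ℝ, ℝ))
      v.proj (g := ContinuousLinearMap.proj (R := ℝ) (φ := fun _ : Fin N => ℝ) i) (f := a)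
      (ContinuousLinearMap.mdifferentiableAt _) hax
    rw [ContinuousLinearMap.mfderiv_eq] at h1
    exact congrArg (fun T : X.E →L[ℝ] ℝ => T v.2) h1

/-- The isomorphism of algebras `Sm(Sym(C^∞(X))) ≃ C^∞(TX)`. -/
noncomputable def completionEquivTangent (X : DiffMan) :
    smoothCompletion (SymDiff.Sym X.Fun) ≃ₐ[ℝ] X.tangentObj.Fun :=
  AlgEquiv.ofBijective X.completionToTangent
    ⟨X.completionToTangent_injective, X.completionToTangent_surjective⟩

end DiffMan

/-- Morphisms out of `Sm(Sym(A))` are determined by their values on the elements `a` and `da`. -/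
theorem smTangent_hom_ext {A B : SmAlg} {φ ψ : smTangent.obj A ⟶ B}
    (h₀ : ∀ a : A.obj, φ.hom.hom (smoothCompletion.unit (SymDiff.Sym A.obj) (algebraMap A.obj _ a)) =
      ψ.hom.hom (smoothCompletion.unit (SymDiff.Sym A.obj) (algebraMap A.obj _ a)))
    (h₁ : ∀ a : A.obj, φ.hom.hom (smoothCompletion.unit (SymDiff.Sym A.obj) (SymDiff.diff a)) =
      ψ.hom.hom (smoothCompletion.unit (SymDiff.Sym A.obj) (SymDiff.diff a))) : φ = ψ := by
  refine ObjectProperty.hom_ext _ (CommAlgCat.hom_ext ?_)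
  refine smoothCompletion.algHom_ext B.property fun s => ?_
  exact congrArg (fun f : SymDiff.Sym A.obj →ₐ[ℝ] B.obj => f s)
    (SymDiff.hom_ext (f := φ.hom.hom.comp (smoothCompletion.unit (SymDiff.Sym A.obj)))
      (g := ψ.hom.hom.comp (smoothCompletion.unit (SymDiff.Sym A.obj))) h₀ h₁)

theorem smTangent_map_algebraMap {A B : SmAlg} (φ : A ⟶ B) (a : A.obj) :
    (smTangent.map φ).hom.hom (smoothCompletion.unit (SymDiff.Sym A.obj) (algebraMap A.obj _ a)) =
      smoothCompletion.unit (SymDiff.Sym B.obj) (algebraMap B.obj _ (φ.hom.hom a)) :=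
  congrArg (smoothCompletion.unit (SymDiff.Sym B.obj)) (SymDiff.mapAlg_algebraMap φ.hom.hom a)

theorem smTangent_map_diff {A B : SmAlg} (φ : A ⟶ B) (a : A.obj) :
    (smTangent.map φ).hom.hom (smoothCompletion.unit (SymDiff.Sym A.obj) (SymDiff.diff a)) =
      smoothCompletion.unit (SymDiff.Sym B.obj) (SymDiff.diff (φ.hom.hom a)) :=
  congrArg (smoothCompletion.unit (SymDiff.Sym B.obj)) (SymDiff.mapAlg_diff φ.hom.hom a)

namespace DiffMan

theorem completionToTangent_algebraMap (X : DiffMan) (c : X.Fun) :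
    X.completionToTangent (smoothCompletion.unit (SymDiff.Sym X.Fun) (algebraMap X.Fun _ c)) =
      X.pullProj c :=
  (smoothCompletion.lift_unit _ _ _).trans (SymDiff.lift_algebraMap _ _ X.differential_mul c)

theorem completionToTangent_diff (X : DiffMan) (c : X.Fun) :
    X.completionToTangent (smoothCompletion.unit (SymDiff.Sym X.Fun) (SymDiff.diff c)) =
      X.differential c :=
  (smoothCompletion.lift_unit _ _ _).trans (SymDiff.lift_diff _ _ X.differential_mul c)

theorem tangent_map_pullProj {X Y : DiffMan} (f : X ⟶ Y) (c : Y.Fun) :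
    (smoothFunctions.map (tangent.map f).op).hom.hom (Y.pullProj c) =
      X.pullProj ((smoothFunctions.map f.op).hom.hom c) := rfl

theorem tangent_map_differential {X Y : DiffMan} (f : X ⟶ Y) (c : Y.Fun) :
    (smoothFunctions.map (tangent.map f).op).hom.hom (Y.differential c) =
      X.differential ((smoothFunctions.map f.op).hom.hom c) :=
  ContMDiffMap.ext fun v => by
    let v : TangentBundle X.I X.carrier := v
    have h := mfderiv_comp v.proj (Y.mdifferentiableAt c (Hom.toMap f v.proj))
      (((Hom.toMap f).contMDiff v.proj).mdifferentiableAt (by simp))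
    exact congrArg (fun T : X.E →L[ℝ] ℝ => T v.2) h.symm

/-- The isomorphism `Sm(Sym(C^∞(X))) ≅ C^∞(TX)`, natural in `X`. -/
noncomputable def smTangentIso :
    smoothFunctions ⋙ smTangent ≅ tangent.op ⋙ smoothFunctions :=
  NatIso.ofComponents
    (fun X => ObjectProperty.isoMk _ (CommAlgCat.isoMk X.unop.completionEquivTangent))
    fun {X Y} f => smTangent_hom_ext (A := smoothFunctions.obj X)
      (B := smoothFunctions.obj (tangent.op.obj Y))
      (fun c => by
        refine (congrArg Y.unop.completionToTangent
          (smTangent_map_algebraMap (smoothFunctions.map f) c)).trans ?_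
        refine (Y.unop.completionToTangent_algebraMap _).trans ?_
        exact (congrArg (smoothFunctions.map (tangent.map f.unop).op).hom.hom
          (X.unop.completionToTangent_algebraMap c)).symm)
      (fun c => by
        refine (congrArg Y.unop.completionToTangent
          (smTangent_map_diff (smoothFunctions.map f) c)).trans ?_
        refine (Y.unop.completionToTangent_diff _).trans ?_
        refine (tangent_map_differential f.unop c).symm.trans ?_
        exact (congrArg (smoothFunctions.map (tangent.map f.unop).op).hom.hom
          (X.unop.completionToTangent_diff c)).symm)

end DiffMan

/-! ### Elements of smooth algebras as maps out of `C^∞(ℝⁿ)` -/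

section Generators

/-- The manifold `ℝⁿ`. -/
noncomputable def DiffMan.euclidean (n : ℕ) : DiffMan where
  carrier := Fin n → ℝ
  E := Fin n → ℝ
  H := Fin n → ℝ
  I := 𝓘(ℝ, Fin n → ℝ)

/-- The `i`-th coordinate function. -/
noncomputable def DiffMan.coord {n : ℕ} (i : Fin n) : (DiffMan.euclidean n).Fun :=
  ⟨fun y : Fin n → ℝ => y i, (contDiff_apply ℝ ℝ i).contMDiff⟩

theorem DiffMan.contDiff_euclidean {n : ℕ} (g : (DiffMan.euclidean n).Fun) :
    ContDiff ℝ ∞ fun y : Fin n → ℝ => g y :=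
  contMDiff_iff_contDiff.1 g.contMDiff

theorem IsSmoothAlg.algHom_euclidean_ext {B : Type} [CommRing B] [Algebra ℝ B]
    (hB : IsSmoothAlg B) {n : ℕ} {φ ψ : (DiffMan.euclidean n).Fun →ₐ[ℝ] B}
    (h : ∀ i, φ (DiffMan.coord i) = ψ (DiffMan.coord i)) : φ = ψ := by
  refine AlgHom.ext fun g => hB.ext fun q => ?_
  have key : ∀ χ : (DiffMan.euclidean n).Fun →ₐ[ℝ] B,
      q (χ g) = g fun i => q (χ (DiffMan.coord i)) := fun χ =>
    RSpec.smooth_apply (RSpec.comap χ q) g DiffMan.coord g fun _ => rfl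
  rw [key, key]
  exact congrArg g (funext fun i => congrArg q (h i))

/-- The homomorphism `C^∞(ℝⁿ) → A`, `g ↦ g(a₁, …, aₙ)`, for elements `aᵢ` of a smooth algebra `A`. -/
noncomputable def IsSmoothAlg.substitute {A : Type} [CommRing A] [Algebra ℝ A]
    (hA : IsSmoothAlg A) {n : ℕ} (a : Fin n → A) : (DiffMan.euclidean n).Fun →ₐ[ℝ] A :=
  hA.equiv.symm.toAlgHom.comp
    { toFun := fun g => smoothCompletion.op _ (DiffMan.contDiff_euclidean g) a
      map_one' := rfl
      map_mul' := fun _ _ => rfl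
      map_zero' := rfl
      map_add' := fun _ _ => rfl
      commutes' := fun _ => rfl }

theorem IsSmoothAlg.substitute_coord {A : Type} [CommRing A] [Algebra ℝ A] (hA : IsSmoothAlg A)
    {n : ℕ} (a : Fin n → A) (i : Fin n) : hA.substitute a (DiffMan.coord i) = a i :=
  hA.equiv.symm_apply_eq.2 rfl

/-- A smooth function as a morphism of manifolds to `ℝ¹`. -/
noncomputable def DiffMan.toLine {X : DiffMan} (c : X.Fun) : X ⟶ DiffMan.euclidean 1 :=
  DiffMan.ofMap (Y := DiffMan.euclidean 1)
    ⟨fun x (_ : Fin 1) => c x, contMDiff_pi_space.2 fun _ => c.contMDiff⟩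

end Generators

namespace SmAlg

/-- `IsSmoothAlg.substitute` as a morphism of smooth algebras. -/
noncomputable def substitute (A : SmAlg) {n : ℕ} (a : Fin n → A.obj) :
    DiffMan.smoothFunctions.obj (Opposite.op (DiffMan.euclidean n)) ⟶ A :=
  ObjectProperty.homMk (CommAlgCat.ofHom (A.property.substitute a))

/-- A morphism out of `C^∞(X)` as an algebra homomorphism. -/
noncomputable def ofFun {A : SmAlg} {X : DiffMan}
    (ψ : DiffMan.smoothFunctions.obj (.op X) ⟶ A) : X.Fun →ₐ[ℝ] A.obj := ψ.hom.hom

/-- An element `ψ c` of the image of `ψ : C^∞(X) ⟶ A` is represented by a map out of `C^∞(ℝ)` that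
factors through `ψ`. -/
theorem toLine_comp (A : SmAlg) {X : DiffMan} (ψ : DiffMan.smoothFunctions.obj (.op X) ⟶ A)
    (c : X.Fun) : DiffMan.smoothFunctions.map (DiffMan.toLine c).op ≫ ψ =
      A.substitute fun _ => ofFun ψ c :=
  ObjectProperty.hom_ext _ <| CommAlgCat.hom_ext <| A.property.algHom_euclidean_ext fun i =>
    (A.property.substitute_coord (fun _ => ofFun ψ c) i).symm

/-- Any two elements of a smooth algebra come from a common algebra of smooth functions. -/
theorem exists_hom_apply_eq (A : SmAlg) (a b : A.obj) :
    ∃ (X : DiffMan) (ψ : DiffMan.smoothFunctions.obj (.op X) ⟶ A) (x y : X.Fun),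
      ofFun ψ x = a ∧ ofFun ψ y = b :=
  ⟨_, A.substitute ![a, b], DiffMan.coord 0, DiffMan.coord 1,
    A.property.substitute_coord _ 0, A.property.substitute_coord _ 1⟩

end SmAlg

/-! ### The Kan extension -/

section KanExtension

open Limits

variable {A : SmAlg} (s : Cocone (CostructuredArrow.proj DiffMan.smoothFunctions A ⋙
  DiffMan.tangent.op ⋙ DiffMan.smoothFunctions))

namespace TangentCocone

/-- The component of the cocone `s` at `ψ : C^∞(X) ⟶ A`. -/
noncomputable def leg {X : DiffMan} (ψ : DiffMan.smoothFunctions.obj (.op X) ⟶ A) :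
    X.tangentObj.Fun →ₐ[ℝ] s.pt.obj :=
  (s.ι.app (CostructuredArrow.mk ψ)).hom.hom

theorem leg_comp {X Y : DiffMan} (f : X ⟶ Y) (ψ : DiffMan.smoothFunctions.obj (.op X) ⟶ A)
    (h : Y.tangentObj.Fun) : leg s (DiffMan.smoothFunctions.map f.op ≫ ψ) h =
      leg s ψ ((DiffMan.smoothFunctions.map (DiffMan.tangent.map f).op).hom.hom h) := by
  let m : CostructuredArrow.mk (DiffMan.smoothFunctions.map f.op ≫ ψ) ⟶ CostructuredArrow.mk ψ :=
    CostructuredArrow.homMk f.op rfl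
  exact (congrArg (fun u => u.hom.hom h) (s.w m)).symm

/-- The value at `a ∈ A ⊆ Sym(A)` of the homomorphism `Sym(A) → s.pt` induced by the cocone `s`. -/
noncomputable def onFunctions (a : A.obj) : s.pt.obj :=
  leg s (A.substitute fun _ : Fin 1 => a) ((DiffMan.euclidean 1).pullProj (DiffMan.coord 0))

/-- The value at `da` of the homomorphism `Sym(A) → s.pt` induced by the cocone `s`. -/
noncomputable def onDifferentials (a : A.obj) : s.pt.obj :=
  leg s (A.substitute fun _ : Fin 1 => a) ((DiffMan.euclidean 1).differential (DiffMan.coord 0))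

variable {X : DiffMan} (ψ : DiffMan.smoothFunctions.obj (.op X) ⟶ A)

theorem onFunctions_apply (c : X.Fun) :
    onFunctions s (SmAlg.ofFun ψ c) = leg s ψ (X.pullProj c) := by
  rw [onFunctions, ← SmAlg.toLine_comp, leg_comp]
  exact congrArg (leg s ψ) (DiffMan.tangent_map_pullProj (DiffMan.toLine c) (DiffMan.coord 0))

theorem onDifferentials_apply (c : X.Fun) :
    onDifferentials s (SmAlg.ofFun ψ c) = leg s ψ (X.differential c) := by
  rw [onDifferentials, ← SmAlg.toLine_comp, leg_comp]
  exact congrArg (leg s ψ)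
    (DiffMan.tangent_map_differential (DiffMan.toLine c) (DiffMan.coord 0))

/-- `onFunctions s` as a homomorphism of algebras. -/
noncomputable def functionsHom : A.obj →ₐ[ℝ] s.pt.obj :=
  have hc : ∀ r, onFunctions s (algebraMap ℝ A.obj r) = algebraMap ℝ s.pt.obj r := fun r => by
    obtain ⟨X, ψ, -⟩ := A.exists_hom_apply_eq 0 0
    rw [← AlgHom.commutes (SmAlg.ofFun ψ) r, onFunctions_apply, AlgHom.commutes, AlgHom.commutes]
  { toFun := onFunctions s
    map_one' := by simpa using hc 1
    map_zero' := by simpa using hc 0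
    map_mul' := fun a b => by
      obtain ⟨X, ψ, x, y, rfl, rfl⟩ := A.exists_hom_apply_eq a b
      refine (congrArg (onFunctions s) (map_mul (SmAlg.ofFun ψ) x y).symm).trans ?_
      rw [onFunctions_apply, onFunctions_apply, onFunctions_apply, ← map_mul, ← map_mul]
    map_add' := fun a b => by
      obtain ⟨X, ψ, x, y, rfl, rfl⟩ := A.exists_hom_apply_eq a b
      refine (congrArg (onFunctions s) (map_add (SmAlg.ofFun ψ) x y).symm).trans ?_
      rw [onFunctions_apply, onFunctions_apply, onFunctions_apply, ← map_add, ← map_add]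
    commutes' := hc }

/-- `onDifferentials s` as a linear map. -/
noncomputable def differentialsLinear : A.obj →ₗ[ℝ] s.pt.obj where
  toFun := onDifferentials s
  map_add' a b := by
    obtain ⟨X, ψ, x, y, rfl, rfl⟩ := A.exists_hom_apply_eq a b
    refine (congrArg (onDifferentials s) (map_add (SmAlg.ofFun ψ) x y).symm).trans ?_
    rw [onDifferentials_apply, onDifferentials_apply, onDifferentials_apply, ← map_add, ← map_add]
  map_smul' r a := by
    obtain ⟨X, ψ, x, -, rfl, -⟩ := A.exists_hom_apply_eq a a
    refine (congrArg (onDifferentials s) (map_smul (SmAlg.ofFun ψ) r x).symm).trans ?_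
    rw [onDifferentials_apply, onDifferentials_apply, RingHom.id_apply, ← map_smul, ← map_smul]

theorem differentialsLinear_mul (a b : A.obj) : differentialsLinear s (a * b) =
    functionsHom s a * differentialsLinear s b + functionsHom s b * differentialsLinear s a := by
  obtain ⟨X, ψ, x, y, rfl, rfl⟩ := A.exists_hom_apply_eq a b
  change onDifferentials s _ =
    onFunctions s _ * onDifferentials s _ + onFunctions s _ * onDifferentials s _
  rw [← map_mul, onDifferentials_apply, onDifferentials_apply, onDifferentials_apply,
    onFunctions_apply, onFunctions_apply,
    X.differential_mul, map_add, map_mul, map_mul]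

/-- The morphism `Sm(Sym(A)) ⟶ s.pt` induced by the cocone `s`. -/
noncomputable def desc : smTangent.obj A ⟶ s.pt :=
  ObjectProperty.homMk (CommAlgCat.ofHom (smoothCompletion.lift s.pt.property
    (SymDiff.lift (functionsHom s) (differentialsLinear s) (differentialsLinear_mul s))))

theorem desc_algebraMap (a : A.obj) : (desc s).hom.hom
    (smoothCompletion.unit (SymDiff.Sym A.obj) (algebraMap A.obj _ a)) = onFunctions s a :=
  (smoothCompletion.lift_unit _ _ _).trans (SymDiff.lift_algebraMap _ _ (differentialsLinear_mul s) a)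

theorem desc_diff (a : A.obj) : (desc s).hom.hom
    (smoothCompletion.unit (SymDiff.Sym A.obj) (SymDiff.diff a)) = onDifferentials s a :=
  (smoothCompletion.lift_unit _ _ _).trans (SymDiff.lift_diff _ _ (differentialsLinear_mul s) a)

theorem map_desc : smTangent.map ψ ≫ desc s =
    DiffMan.smTangentIso.hom.app (.op X) ≫ s.ι.app (CostructuredArrow.mk ψ) :=
  smTangent_hom_ext
    (fun c => (congrArg (desc s).hom.hom (smTangent_map_algebraMap ψ c)).trans <|
      (desc_algebraMap s _).trans <| (onFunctions_apply s ψ c).trans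
        (congrArg (leg s ψ) (X.completionToTangent_algebraMap c)).symm)
    (fun c => (congrArg (desc s).hom.hom (smTangent_map_diff ψ c)).trans <|
      (desc_diff s _).trans <| (onDifferentials_apply s ψ c).trans
        (congrArg (leg s ψ) (X.completionToTangent_diff c)).symm)

theorem desc_unique (m : smTangent.obj A ⟶ s.pt)
    (hm : ∀ (X : DiffMan) (ψ : DiffMan.smoothFunctions.obj (.op X) ⟶ A), smTangent.map ψ ≫ m =
      DiffMan.smTangentIso.hom.app (.op X) ≫ s.ι.app (CostructuredArrow.mk ψ)) : m = desc s := by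
  have h : ∀ (X : DiffMan) (ψ : DiffMan.smoothFunctions.obj (.op X) ⟶ A),
      smTangent.map ψ ≫ m = smTangent.map ψ ≫ desc s := fun X ψ =>
    (hm X ψ).trans (map_desc s ψ).symm
  refine smTangent_hom_ext (fun a => ?_) fun a => ?_
  · obtain ⟨X, ψ, x, -, rfl, -⟩ := A.exists_hom_apply_eq a a
    refine (congrArg m.hom.hom (smTangent_map_algebraMap ψ x)).symm.trans <| Eq.trans ?_
      (congrArg (desc s).hom.hom (smTangent_map_algebraMap ψ x))
    exact congrArg (fun u => u.hom.hom (smoothCompletion.unit (SymDiff.Sym X.Fun)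
      (algebraMap X.Fun _ x))) (h X ψ)
  · obtain ⟨X, ψ, x, -, rfl, -⟩ := A.exists_hom_apply_eq a a
    refine (congrArg m.hom.hom (smTangent_map_diff ψ x)).symm.trans <| Eq.trans ?_
      (congrArg (desc s).hom.hom (smTangent_map_diff ψ x))
    exact congrArg (fun u => u.hom.hom (smoothCompletion.unit (SymDiff.Sym X.Fun)
      (SymDiff.diff x))) (h X ψ)

end TangentCocone

/-- The Kan extension is even pointwise. -/
theorem smTangent_isLeftKanExtension :
    smTangent.IsLeftKanExtension DiffMan.smTangentIso.inv :=
  Functor.LeftExtension.IsPointwiseLeftKanExtension.isLeftKanExtension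
    (E := Functor.LeftExtension.mk smTangent DiffMan.smTangentIso.inv) fun A =>
    { desc := fun s => TangentCocone.desc s
      fac := fun s j => by
        refine (Category.assoc _ _ _).trans ?_
        refine (congrArg (DiffMan.smTangentIso.inv.app j.left ≫ ·)
          (TangentCocone.map_desc s (X := j.left.unop) j.hom)).trans ?_
        exact DiffMan.smTangentIso.inv_hom_id_app_assoc _ _
      uniq := fun s m hm => TangentCocone.desc_unique s m fun X ψ => by
        rw [← hm (CostructuredArrow.mk ψ)]
        exact ((DiffMan.smTangentIso.hom_inv_id_app_assoc (.op X) _).symm.trans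
          (congrArg (DiffMan.smTangentIso.hom.app (.op X) ≫ ·) (Category.assoc _ _ _).symm)) }

end KanExtension

theorem smTangentEmbedding_injective (A : SmAlg) :
    Function.Injective (smTangentEmbedding.app A).hom.hom := fun a b h =>
  A.property.ext fun p => by
    -- The real point `p` of `A`, extended to `Sym(A)` by zero on differentials.
    let q : RSpec (SymDiff.Sym A.obj) :=
      RSpec.comap ((SymmetricAlgebra.algebraMapInv (R := A.obj)
        (M := Ω[A.obj⁄ℝ])).restrictScalars ℝ) p
    have hq : ∀ c : A.obj, q (algebraMap A.obj _ c) = p c := fun c =>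
      congrArg p (SymmetricAlgebra.algebraMap_leftInverse _ c)
    rw [← hq, ← hq]
    exact congrArg (fun g : smoothCompletion (SymDiff.Sym A.obj) => g.1 q) h

theorem proj_comp_smTangentIso_inv (X : DiffMan) :
    DiffMan.smoothFunctions.map (DiffMan.proj.app X).op ≫ DiffMan.smTangentIso.inv.app (.op X) =
      smTangentEmbedding.app (DiffMan.smoothFunctions.obj (.op X)) := by
  rw [← cancel_mono (DiffMan.smTangentIso.hom.app (.op X)), Category.assoc,
    Iso.inv_hom_id_app, Category.comp_id]
  refine ObjectProperty.hom_ext _ (CommAlgCat.hom_ext (AlgHom.ext fun c => ?_))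
  exact (X.completionToTangent_algebraMap c).symm

theorem proposition3p1p1 :
    ∃ e : DiffMan.tangent.op ⋙ DiffMan.smoothFunctions ≅ DiffMan.smoothFunctions ⋙ smTangent,
      smTangent.IsLeftKanExtension e.hom ∧
      (∀ X : DiffMan,
        DiffMan.smoothFunctions.map (DiffMan.proj.app X).op ≫ e.hom.app (Opposite.op X)
          = smTangentEmbedding.app (DiffMan.smoothFunctions.obj (Opposite.op X))) ∧
      ∀ A : SmAlg, Function.Injective (smTangentEmbedding.app A).hom.hom :=
  ⟨DiffMan.smTangentIso.symm, smTangent_isLeftKanExtension, proj_comp_smTangentIso_inv,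
    smTangentEmbedding_injective⟩
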